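/- A semiring $S=(S,+,\cdot,0,1)$ is a commutative monoid $(S,+,0)$ and a monoid $(S,\cdot,1)$, with multiplication distributing over addition on both sides and $0s=0=s0$ for all $s$. It is anti-bounded if every $s\in S$ has an additive inverse or is of the form $s=1+t$ with $t\in S$. A left $S$-semimodule is a commutative monoid with a unital, biadditive, associative left action of $S$ satisfying $s0=0=0m$; right semimodules are defined similarly. A semimodule is cyclic if it is a homomorphic image of the regular semimodule $S$, and a semimodule $M$ is injective if for every injective homomorphism $i\colon A\to B$ of semimodules and every homomorphism $f\colon A\to M$ there is a homomorphism $g\colon B\to M$ with $gi=f$. $S$ is a left (right) CI-semiring if all its cyclic left (right) semimodules are injective. Let $\mathbf B=\{0,1\}$ be the Boolean semiring (with $1+1=1$), and let $\mathbf B_3$ be the semiring on the chain $0<1<2$ with $x+y=\max(x,y)$, and with $xy=0$ if $x=0$ or $y=0$ and $xy=\max(x,y)$ otherwise. For a ring $R$ with identity $1$, let $\mathrm{Ext}(R)=R\cup\{0,\infty\}$, where $0$ and $\infty$ are two new elements (so $0$ is not the zero of $R$): the operations extend those of $R$, with $0+x=x=x+0$ and $0x=0=x0$ for all $x\in\mathrm{Ext}(R)$,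 with $x+\infty=\infty=\infty+x$ for all $x\in\mathrm{Ext}(R)$, and with $x\infty=\infty=\infty x$ for all $x\in R\cup\{\infty\}$; its identity is the $1$ of $R$. Theorem. An anti-bounded semiring $S$ is a left (respectively, right) CI-semiring if and only if one of the following holds: (1) $S$ is a semisimple ring; (2) $S\cong\mathbf B$, or $S\cong\mathbf B_3$, or $S\cong\mathrm{Ext}(R)$ for some nonzero semisimple ring $R$; (3) $S\cong R\oplus T$ (a direct sum, i.e. direct product, of semirings), where $R$ is a semisimple ring and $T$ is isomorphic to $\mathbf B$, or to $\mathbf B_3$, or to $\mathrm{Ext}(R')$ for some nonzero semisimple ring $R'$. Here the zero ring counts as a semisimple ring. -/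

import Mathlib

universe u v

/-- `V(S) ∪ {1 + s | s ∈ S} = S`: every element is additively invertible or of the form `1 + t`. -/
def IsAntiBounded (S : Type u) [Semiring S] : Prop :=
  ∀ s : S, (∃ t : S, s + t = 0) ∨ ∃ t : S, s = 1 + t

/-- A (left) `S`-semimodule `M` is injective if every homomorphism `A → M` extends along every
monomorphism (i.e. injective homomorphism) `A → B` of semimodules.  Only additive commutative
monoids are involved: no subtraction is assumed. -/
def IsInjectiveSemimodule (S : Type u) [Semiring S] (M : Type v) [AddCommMonoid M] [Module S M] :
    Prop :=
  ∀ (A B : Type v) [AddCommMonoid A] [AddCommMonoid B] [Module S A] [Module S B]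
    (i : A →ₗ[S] B) (_ : Function.Injective i) (f : A →ₗ[S] M),
    ∃ g : B →ₗ[S] M, g.comp i = f

/-- All cyclic left semimodules (homomorphic images of the regular left semimodule) are
injective. -/
def IsLeftCISemiring (S : Type u) [Semiring S] : Prop :=
  ∀ (M : Type u) [AddCommMonoid M] [Module S M],
    (∃ p : S →ₗ[S] M, Function.Surjective p) → IsInjectiveSemimodule S M

/-- All cyclic right semimodules (homomorphic images of the regular right semimodule) are
injective.  Right `S`-semimodules are modules over the opposite semiring `Sᵐᵒᵖ`. -/
def IsRightCISemiring (S : Type u) [Semiring S] : Prop :=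
  ∀ (M : Type u) [AddCommMonoid M] [Module Sᵐᵒᵖ M],
    (∃ p : S →ₗ[Sᵐᵒᵖ] M, Function.Surjective p) → IsInjectiveSemimodule Sᵐᵒᵖ M

/-- The semiring `S` is a ring (its semiring structure underlies a ring structure), and this
ring is semisimple. -/
def IsSemisimpleRingAsSemiring (S : Type u) [hS : Semiring S] : Prop :=
  ∃ r : Ring S, r.toSemiring = hS ∧ IsSemisimpleRing S

/-- The Boolean semiring `{0, 1}`, with `1 + 1 = 1`. -/
def BooleanSemiring : Type := Bool

namespace BooleanSemiring

instance : DecidableEq BooleanSemiring := inferInstanceAs (DecidableEq Bool)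
instance : Fintype BooleanSemiring := inferInstanceAs (Fintype Bool)
instance : Zero BooleanSemiring := ⟨false⟩
instance : One BooleanSemiring := ⟨true⟩
instance : Add BooleanSemiring := ⟨fun x y => Bool.or x y⟩
instance : Mul BooleanSemiring := ⟨fun x y => Bool.and x y⟩

instance : Semiring BooleanSemiring where
  add_assoc := by decide
  zero_add := by decide
  add_zero := by decide
  add_comm := by decide
  mul_assoc := by decide
  one_mul := by decide
  mul_one := by decide
  zero_mul := by decide
  mul_zero := by decide
  left_distrib := by decide
  right_distrib := by decide
  nsmul := nsmulRec

end BooleanSemiring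

/-- The semiring with `n + 1` elements on the chain `0 < 1 < ⋯ < n` (`n ≥ 1`): the sum is the
maximum; the product is the maximum on nonzero elements, and `0` if one factor is `0`. -/
def ChainSemiring (n : ℕ) [NeZero n] : Type := Fin (n + 1)

namespace ChainSemiring

variable {n : ℕ} [NeZero n]

instance : LinearOrder (ChainSemiring n) := inferInstanceAs (LinearOrder (Fin (n + 1)))
instance : Zero (ChainSemiring n) := ⟨(0 : Fin (n + 1))⟩
instance : One (ChainSemiring n) :=
  ⟨(⟨1, Nat.succ_lt_succ (Nat.pos_of_ne_zero (NeZero.ne n))⟩ : Fin (n + 1))⟩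
instance : Add (ChainSemiring n) := ⟨fun x y => max x y⟩
instance : Mul (ChainSemiring n) := ⟨fun x y => if x = 0 ∨ y = 0 then 0 else max x y⟩

theorem add_def (x y : ChainSemiring n) : x + y = max x y := rfl

theorem mul_def (x y : ChainSemiring n) : x * y = if x = 0 ∨ y = 0 then 0 else max x y := rfl

theorem zero_le' (x : ChainSemiring n) : 0 ≤ x := Fin.zero_le (n := n + 1) x

theorem one_le' {x : ChainSemiring n} (hx : x ≠ 0) : 1 ≤ x := by
  change (1 : ℕ) ≤ Fin.val (n := n + 1) x
  exact Nat.one_le_iff_ne_zero.2 fun h => hx (Fin.ext h)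

theorem one_ne_zero' : (1 : ChainSemiring n) ≠ 0 := fun h =>
  Nat.one_ne_zero (congrArg (Fin.val (n := n + 1)) h)

theorem max_ne_zero {x y : ChainSemiring n} (hx : x ≠ 0) : max x y ≠ 0 := fun h =>
  hx (le_antisymm (h ▸ le_max_left x y) (zero_le' x))

theorem max_ne_zero' {x y : ChainSemiring n} (hy : y ≠ 0) : max x y ≠ 0 := fun h =>
  hy (le_antisymm (h ▸ le_max_right x y) (zero_le' y))

theorem mul_comm' (x y : ChainSemiring n) : x * y = y * x := by
  simp only [mul_def, or_comm, max_comm]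

theorem mul_assoc' (x y z : ChainSemiring n) : x * y * z = x * (y * z) := by
  by_cases hx : x = 0 <;> by_cases hy : y = 0 <;> by_cases hz : z = 0 <;>
    simp [mul_def, hx, hy, hz, max_ne_zero, max_assoc]

theorem one_mul' (x : ChainSemiring n) : 1 * x = x := by
  by_cases hx : x = 0
  · simp [mul_def, hx]
  · simp [mul_def, hx, one_ne_zero', one_le' hx]

theorem left_distrib' (x y z : ChainSemiring n) : x * (y + z) = x * y + x * z := by
  by_cases hx : x = 0
  · simp [mul_def, add_def, hx]
  by_cases hy : y = 0
  · simp [mul_def, add_def, hy, zero_le']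
  by_cases hz : z = 0
  · simp [mul_def, add_def, hz, zero_le']
  simp only [mul_def, add_def, hx, hy, hz, max_ne_zero hy, or_self, if_false]
  exact sup_sup_distrib_left x y z

instance : Semiring (ChainSemiring n) where
  add_assoc := max_assoc
  zero_add x := max_eq_right (zero_le' x)
  add_zero x := max_eq_left (zero_le' x)
  add_comm := max_comm
  mul_assoc := mul_assoc'
  one_mul := one_mul'
  mul_one x := by rw [mul_comm', one_mul']
  zero_mul x := by simp [mul_def]
  mul_zero x := by simp [mul_def]
  left_distrib := left_distrib'
  right_distrib x y z := by rw [mul_comm', left_distrib', mul_comm' z x, mul_comm' z y]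
  nsmul := nsmulRec

end ChainSemiring

/-- The underlying set `R ∪ {0, ∞}` of `Ext(R)`: the ring `R` together with a new zero element
and an infinite element, both outside `R`. -/
inductive ExtSemiring (R : Type u) : Type u
  | zero : ExtSemiring R
  | of (r : R) : ExtSemiring R
  | infty : ExtSemiring R

namespace ExtSemiring

variable {R : Type u} [Ring R]

/-- The new zero is neutral, elements of `R` are added in `R`, and `x + ∞ = ∞ + x = ∞`. -/
def add : ExtSemiring R → ExtSemiring R → ExtSemiring R
  | zero, y => y
  | x, zero => x
  | of r, of s => of (r + s)
  | _, _ => infty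

/-- The new zero is absorbing, elements of `R` are multiplied in `R`, and `x ∞ = ∞ x = ∞` for
`x` other than the new zero (in particular when `x` is the zero of `R`). -/
def mul : ExtSemiring R → ExtSemiring R → ExtSemiring R
  | zero, _ => zero
  | _, zero => zero
  | of r, of s => of (r * s)
  | _, _ => infty

instance : Zero (ExtSemiring R) := ⟨zero⟩
instance : One (ExtSemiring R) := ⟨of 1⟩
instance : Add (ExtSemiring R) := ⟨add⟩
instance : Mul (ExtSemiring R) := ⟨mul⟩

instance : Semiring (ExtSemiring R) where
  add_assoc x y z := by
    change add (add x y) z = add x (add y z)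
    cases x <;> cases y <;> cases z <;> simp [add, add_assoc]
  zero_add x := by
    change add zero x = x
    cases x <;> rfl
  add_zero x := by
    change add x zero = x
    cases x <;> rfl
  add_comm x y := by
    change add x y = add y x
    cases x <;> cases y <;> simp [add, add_comm]
  mul_assoc x y z := by
    change mul (mul x y) z = mul x (mul y z)
    cases x <;> cases y <;> cases z <;> simp [mul, mul_assoc]
  one_mul x := by
    change mul (of 1) x = x
    cases x <;> simp [mul]
  mul_one x := by
    change mul x (of 1) = x
    cases x <;> simp [mul]
  zero_mul x := by
    change mul zero x = zero
    cases x <;> rfl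
  mul_zero x := by
    change mul x zero = zero
    cases x <;> rfl
  left_distrib x y z := by
    change mul x (add y z) = add (mul x y) (mul x z)
    cases x <;> cases y <;> cases z <;> simp [add, mul, mul_add]
  right_distrib x y z := by
    change mul (add x y) z = add (mul x z) (mul y z)
    cases x <;> cases y <;> cases z <;> simp [add, mul, add_mul]
  nsmul := nsmulRec

end ExtSemiring

/-- `T` is isomorphic to the Boolean semiring, to the three-element chain semiring, or to
`Ext(R)` for some nonzero semisimple ring `R`. -/
def IsBooleanOrChainOrExt (T : Type u) [Semiring T] : Prop :=
  Nonempty (T ≃+* BooleanSemiring) ∨ Nonempty (T ≃+* ChainSemiring 2) ∨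
    ∃ (R : Type u) (_ : Ring R), Nontrivial R ∧ IsSemisimpleRing R ∧
      Nonempty (T ≃+* ExtSemiring R)

/-- `S` is a direct sum (product) `R ⊕ T` of semirings, with `R` a semisimple ring and `T`
isomorphic to the Boolean semiring, to the three-element chain semiring, or to `Ext(R')` for
some nonzero semisimple ring `R'`. -/
def IsSemisimpleRingSumBooleanOrChainOrExt (S : Type u) [Semiring S] : Prop :=
  ∃ (R : Type u) (_ : Ring R) (T : Type u) (_ : Semiring T),
    IsSemisimpleRing R ∧ IsBooleanOrChainOrExt T ∧ Nonempty (S ≃+* R × T)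

/-!
Left and right are interchanged by passing to the opposite semiring, so only left semimodules are
considered until the end, where the classification itself shows that the left property implies the
right one.

**CI-semirings are of the listed form.** Except in the proof that certain rings are semisimple,
injectivity enters only through retractions: if the additive monoid of a homomorphic image `T` of
`S` embeds into a commutative monoid `N`, then `T` is a retract of the coinduced semimodule of
additive maps `S → N` (`IsLeftCISemiring.exists_retraction`), and the retraction carries
well-chosen additive maps to elements of `T` with prescribed properties.

Let `V` be the ideal of additively invertible elements of `S`. The quotient `S / V` is zerosumfree
and all its nonzero elements are of the form `1 + t`. Adjoining `∞` gives it an infinite element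
(`exists_infinite_element`), whose lift `W` satisfies `1 + W = W + ε` with `ε ∈ V`. Multiplying by
elements of `V` shows that `ε` is an identity element of `V`, so it is a central idempotent and
`S` is the product of the ring `V` and of `S / V` (`exists_equiv_prod`).

Now let `S` be zerosumfree and nontrivial. If `1` were not of the form `1 + 1 + t`, the natural
numbers truncated at `2` would be a CI-semiring, and a retraction would give three of their
elements, any two with sum `1`, which is absurd (`not_isLeftCISemiring_truncNat`). Hence there is
`e ≠ 0` with `1 + e = 1`; it is neutral for the addition of nonzero elements, and the elements
with a negative with respect to `e` form a ring `R` with zero `e`. Only the infinite element lies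
outside of `R ∪ {0}` (`eq_infinite_element`), so `S` is the Boolean semiring or `Ext(R)`, and the
three-element chain is `Ext(0)`.

Finally, the rings that occur are semisimple by Osofsky's theorem that a ring with injective
cyclic modules is semisimple (`CyclicBaer.isSemisimpleRing`). It is proved by Osofsky's argument:
the ring is von Neumann regular and self-injective, and if it is not semisimple it has an infinite
family of orthogonal idempotents, from which a cyclic module without the extension property is
constructed.

**The listed semirings are CI-semirings.** Products of CI-semirings are CI-semirings. A nonzero
cyclic semimodule over `Ext(R)` has two elements or is `N ∪ {0, ∞}` for an `R`-module `N`. To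
extend a homomorphism `f` with values in the latter from `A` to `B ⊇ A`, consider the `b ∈ B` for
which `0_R b` lies below some idempotent `0_R a` with `f a ≠ ∞`. Identifying those that agree
after such an idempotent is added to both gives an `R`-module, a direct limit of `R`-modules, and
injectivity of `N` over the semisimple ring `R` applies there (`ExtModule.isInjectiveSemimodule`).
-/

universe w

/-! ### Change of semiring -/

/-- A homomorphic image `T` of a left CI-semiring `S` is a left CI-semiring: cyclic
`T`-semimodules are cyclic `S`-semimodules, and `S`-linear maps between `T`-semimodules are
`T`-linear. -/
theorem IsLeftCISemiring.of_surjective {S T : Type u} [Semiring S] [Semiring T]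
    (hS : IsLeftCISemiring S) (π : S →+* T) (hπ : Function.Surjective π) :
    IsLeftCISemiring T := by
  intro M _ _ ⟨p, hp⟩ A B _ _ _ _ i hi f
  let : Module S M := Module.compHom M π
  let : Module S A := Module.compHom A π
  let : Module S B := Module.compHom B π
  let p' : S →ₗ[S] M :=
    { toFun := fun s => p (π s)
      map_add' := by simp
      map_smul' := fun s t => by
        rw [smul_eq_mul, π.map_mul]
        exact p.map_smul (π s) (π t) }
  let i' : A →ₗ[S] B := { i with map_smul' := fun s a => i.map_smul (π s) a }
  let f' : A →ₗ[S] M := { f with map_smul' := fun s a => f.map_smul (π s) a }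
  obtain ⟨g, hg⟩ := hS M ⟨p', hp.comp hπ⟩ A B i' hi f'
  refine ⟨{ g with map_smul' := fun t b => ?_ }, ?_⟩
  · obtain ⟨s, rfl⟩ := hπ t
    exact g.map_smul s b
  · ext a
    exact LinearMap.congr_fun hg a

theorem isLeftCISemiring_congr {S T : Type u} [Semiring S] [Semiring T] (e : S ≃+* T) :
    IsLeftCISemiring S ↔ IsLeftCISemiring T :=
  ⟨fun h => h.of_surjective e.toRingHom e.surjective,
    fun h => h.of_surjective e.symm.toRingHom e.symm.surjective⟩

/-- Injectivity of semimodules is invariant under isomorphism. -/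
theorem IsInjectiveSemimodule.of_equiv {S : Type u} [Semiring S] {M N : Type v}
    [AddCommMonoid M] [AddCommMonoid N] [Module S M] [Module S N]
    (hM : IsInjectiveSemimodule S M) (e : M ≃ₗ[S] N) : IsInjectiveSemimodule S N := by
  intro A B _ _ _ _ i hi f
  obtain ⟨g, hg⟩ := hM A B i hi (e.symm.toLinearMap.comp f)
  refine ⟨e.toLinearMap.comp g, ?_⟩
  ext a
  have := LinearMap.congr_fun hg a
  simp only [LinearMap.comp_apply] at this
  simp [this]

theorem isInjectiveSemimodule_of_subsingleton {S : Type u} [Semiring S] {M : Type v}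
    [AddCommMonoid M] [Module S M] [Subsingleton M] : IsInjectiveSemimodule S M :=
  fun _ _ _ _ _ _ _ _ _ => ⟨0, LinearMap.ext fun _ => Subsingleton.elim _ _⟩

/-- Right semimodules over `S` are left semimodules over the opposite semiring. -/
theorem isRightCISemiring_iff_op {S : Type u} [Semiring S] :
    IsRightCISemiring S ↔ IsLeftCISemiring Sᵐᵒᵖ := by
  let e : Sᵐᵒᵖ ≃ₗ[Sᵐᵒᵖ] S :=
    { toFun := MulOpposite.unop
      invFun := MulOpposite.op
      map_add' := fun _ _ => rfl
      map_smul' := fun _ _ => rfl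
      left_inv := fun _ => rfl
      right_inv := fun _ => rfl }
  constructor
  · rintro h M _ _ ⟨p, hp⟩
    exact h M ⟨p.comp e.symm.toLinearMap, hp.comp e.symm.surjective⟩
  · rintro h M _ _ ⟨p, hp⟩
    exact h M ⟨p.comp e.toLinearMap, hp.comp e.surjective⟩

/-! ### Coinduced semimodules -/

/-- The left `S`-semimodule coinduced from a commutative monoid `N`: additive maps `S → N`, with
`s` acting by precomposition with right multiplication by `s`. -/
def Coinduced (S : Type u) (N : Type v) [Semiring S] [AddCommMonoid N] : Type (max u v) :=
  S →+ N

namespace Coinduced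

variable {S : Type u} {N : Type v} [Semiring S] [AddCommMonoid N]

instance : AddCommMonoid (Coinduced S N) := inferInstanceAs (AddCommMonoid (S →+ N))

instance : Module S (Coinduced S N) where
  smul s φ := AddMonoidHom.comp φ (AddMonoidHom.mulRight s)
  one_smul φ := AddMonoidHom.ext fun t => congrArg (DFunLike.coe (F := S →+ N) φ) (mul_one t)
  mul_smul s s' φ := AddMonoidHom.ext fun t =>
    congrArg (DFunLike.coe (F := S →+ N) φ) (mul_assoc t s s').symm
  smul_zero _ := rfl
  smul_add _ _ _ := rfl
  add_smul s s' φ := AddMonoidHom.ext fun t =>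
    (congrArg (DFunLike.coe (F := S →+ N) φ) (mul_add t s s')).trans (AddMonoidHom.map_add φ _ _)
  zero_smul φ := AddMonoidHom.ext fun t =>
    (congrArg (DFunLike.coe (F := S →+ N) φ) (mul_zero t)).trans (AddMonoidHom.map_zero φ)

end Coinduced

/-- A homomorphic image `T` of a left CI-semiring `S` is a retract, as an `S`-semimodule, of every
coinduced semimodule into which it embeds.  An embedding `ψ` of the additive monoid of `T` into `N`
yields such an embedding `m ↦ (t ↦ ψ (t m))`.  This is the source of all elements that are
constructed in a CI-semiring. -/
theorem IsLeftCISemiring.exists_retraction {S T N : Type u} [Semiring S] [Semiring T]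
    [AddCommMonoid N] (hS : IsLeftCISemiring S) (π : S →+* T) (hπ : Function.Surjective π)
    (ψ : T →+ N) (hψ : Function.Injective ψ) :
    ∃ g : (S →+ N) →+ T, (∀ s φ, g (φ.comp (AddMonoidHom.mulRight s)) = π s * g φ) ∧
      ∀ m, g (ψ.comp ((AddMonoidHom.mulRight m).comp (π : S →+ T))) = m := by
  let : Module S T := Module.compHom T π
  let p : S →ₗ[S] T := { (π : S →+ T) with map_smul' := fun s t => π.map_mul s t }
  let i : T →ₗ[S] Coinduced S N :=
    { toFun := fun m => (ψ.comp ((AddMonoidHom.mulRight m).comp (π : S →+ T)) : S →+ N)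
      map_add' := fun m m' => AddMonoidHom.ext fun t => by
        change ψ (π t * (m + m')) = ψ (π t * m) + ψ (π t * m')
        rw [mul_add, map_add]
      map_smul' := fun s m => AddMonoidHom.ext fun t => by
        change ψ (π t * (π s * m)) = ψ (π (t * s) * m)
        rw [π.map_mul, mul_assoc] }
  have hi : Function.Injective i := by
    intro m m' h
    have h1 : ψ (π 1 * m) = ψ (π 1 * m') := DFunLike.congr_fun (F := S →+ N) h 1
    simpa using hψ h1
  obtain ⟨g, hg⟩ := hS T ⟨p, hπ⟩ T (Coinduced S N) i hi LinearMap.id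
  exact ⟨g.toAddMonoidHom, fun s φ => g.map_smul s φ, fun m => LinearMap.congr_fun hg m⟩

/-! ### Products -/

/-- Let `j : R → S` be the inclusion of a direct factor, with `p` the projection.  If `R` is a left
CI-semiring, then maps into a cyclic `S`-semimodule `M` extend after projection to the `R`-component
`{m | j 1 • m = m}`. -/
theorem IsLeftCISemiring.exists_extend_component {R S : Type u} [Semiring R] [Semiring S]
    (hR : IsLeftCISemiring R) (j : R →ₙ+* S) (p : S →+* R) (hpj : ∀ r, p (j r) = r)
    (hl : ∀ s, j 1 * s = j (p s)) (hr : ∀ s, s * j 1 = j (p s))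
    {M A B : Type u} [AddCommMonoid M] [AddCommMonoid A] [AddCommMonoid B]
    [Module S M] [Module S A] [Module S B] (q : S →ₗ[S] M) (hq : Function.Surjective q)
    (i : A →ₗ[S] B) (hi : Function.Injective i) (f : A →ₗ[S] M) :
    ∃ g : B →ₗ[S] M, ∀ a, g (i a) = j 1 • f a := by
  have hj1 : ∀ r, j 1 * j r = j r := fun r => by rw [hl, hpj]
  have hp1 : ∀ s, p s • (1 : R) = p s := fun s => by simp
  let C (X : Type u) [AddCommMonoid X] [Module S X] : AddSubmonoid X :=
    { carrier := {x | j 1 • x = x}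
      zero_mem' := smul_zero _
      add_mem' := fun {x y} hx hy => by
        change j 1 • (x + y) = x + y
        rw [smul_add, show j 1 • x = x from hx, show j 1 • y = y from hy] }
  let (X : Type u) [AddCommMonoid X] [Module S X] : Module R (C X) :=
    { smul := fun r x => ⟨j r • (x : X), by
        change j 1 • j r • (x : X) = j r • (x : X)
        rw [← mul_smul, hj1]⟩
      one_smul := fun x => Subtype.ext x.2
      mul_smul := fun r r' x => Subtype.ext <| by
        change j (r * r') • (x : X) = j r • j r' • (x : X)
        rw [map_mul, mul_smul]
      smul_zero := fun r => Subtype.ext (smul_zero (j r))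
      smul_add := fun r x y => Subtype.ext (smul_add (j r) (x : X) (y : X))
      add_smul := fun r r' x => Subtype.ext <| by
        change j (r + r') • (x : X) = j r • (x : X) + j r' • (x : X)
        rw [map_add, add_smul]
      zero_smul := fun x => Subtype.ext <| by
        change j 0 • (x : X) = 0
        rw [map_zero, zero_smul] }
  have coe_smul (X : Type u) [AddCommMonoid X] [Module S X] (r : R) (x : C X) :
      ((r • x : C X) : X) = j r • (x : X) := rfl
  let map {X Y : Type u} [AddCommMonoid X] [Module S X] [AddCommMonoid Y] [Module S Y]
      (h : X →ₗ[S] Y) : C X →ₗ[R] C Y :=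
    { toFun := fun x => ⟨h x, by
        change j 1 • h x = h x
        rw [← h.map_smul, show j 1 • (x : X) = x from x.2]⟩
      map_add' := fun x y => Subtype.ext (h.map_add x y)
      map_smul' := fun r x => Subtype.ext (h.map_smul (j r) x) }
  let pr (X : Type u) [AddCommMonoid X] [Module S X] (x : X) : C X := ⟨j 1 • x, by
        change j 1 • j 1 • x = j 1 • x
        rw [← mul_smul, hj1]⟩
  let qR : R →ₗ[R] C M :=
    { toFun := fun r => ⟨q (j r), by
        change j 1 • q (j r) = q (j r)
        rw [← q.map_smul, smul_eq_mul, hj1]⟩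
      map_add' := fun r r' => Subtype.ext <| by
        change q (j (r + r')) = q (j r) + q (j r')
        rw [map_add, map_add]
      map_smul' := fun r r' => Subtype.ext <| by
        change q (j (r * r')) = j r • q (j r')
        rw [map_mul, ← smul_eq_mul, q.map_smul] }
  have hqR : Function.Surjective qR := by
    intro m
    obtain ⟨s, hs⟩ := hq m
    refine ⟨p s, Subtype.ext ?_⟩
    change q (j (p s)) = m
    rw [← hl, ← smul_eq_mul, q.map_smul, hs]
    exact m.2
  have hmap : Function.Injective (map i) := fun x y h =>
    Subtype.ext (hi (congrArg Subtype.val h))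
  obtain ⟨g, hg⟩ := hR (C M) ⟨qR, hqR⟩ (C A) (C B) (map i) hmap (map f)
  refine ⟨{ toFun := fun b => (g (pr B b) : M), map_add' := fun b b' => ?_,
            map_smul' := fun s b => ?_ }, fun a => ?_⟩
  · rw [← AddSubmonoid.coe_add, ← map_add]
    congr 2
    exact Subtype.ext (smul_add _ _ _)
  · have h1 : pr B (s • b) = p s • pr B b := Subtype.ext <| by
      change j 1 • s • b = j (p s) • j 1 • b
      rw [← mul_smul, ← mul_smul, hl, hr, hpj]
    have h2 : j 1 • (g (pr B b) : M) = (g (pr B b) : M) := (g (pr B b)).2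
    change (g (pr B (s • b)) : M) = s • (g (pr B b) : M)
    rw [h1, g.map_smul, coe_smul]
    conv_rhs => rw [← h2, ← mul_smul, hr]
  · have h1 : pr B (i a) = map i (pr A a) := Subtype.ext (i.map_smul (j 1) a).symm
    have h2 := LinearMap.congr_fun hg (pr A a)
    change (g (pr B (i a)) : M) = j 1 • f a
    rw [h1, ← f.map_smul]
    exact congrArg Subtype.val h2

/-- A product of two left CI-semirings is a left CI-semiring. -/
theorem IsLeftCISemiring.prod {R T : Type u} [Semiring R] [Semiring T]
    (hR : IsLeftCISemiring R) (hT : IsLeftCISemiring T) : IsLeftCISemiring (R × T) := by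
  intro M _ _ ⟨q, hq⟩ A B _ _ _ _ i hi f
  let j₁ : R →ₙ+* R × T := (NonUnitalRingHom.id R).prod 0
  let j₂ : T →ₙ+* R × T := NonUnitalRingHom.prod 0 (NonUnitalRingHom.id T)
  obtain ⟨g₁, h₁⟩ := hR.exists_extend_component j₁ (RingHom.fst R T) (fun _ => rfl)
    (fun s => by ext <;> simp [j₁]) (fun s => by ext <;> simp [j₁]) q hq i hi f
  obtain ⟨g₂, h₂⟩ := hT.exists_extend_component j₂ (RingHom.snd R T) (fun _ => rfl)
    (fun s => by ext <;> simp [j₂]) (fun s => by ext <;> simp [j₂]) q hq i hi f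
  refine ⟨g₁ + g₂, LinearMap.ext fun a => ?_⟩
  have h : j₁ 1 + j₂ 1 = 1 := by ext <;> simp [j₁, j₂]
  simp only [LinearMap.comp_apply, LinearMap.add_apply]
  rw [h₁, h₂, ← add_smul, h, one_smul]

/-! ### Rings whose cyclic modules are injective -/

/-- The extension property of the cyclic left modules `R ⧸ I` along left ideals, phrased through
graphs: a submodule `G` of `R × R ⧸ I` that is the graph of a homomorphism from a left ideal to
`R ⧸ I` is contained in the graph of `x ↦ x • c` for some `c`. -/
def CyclicBaer (R : Type u) [Ring R] : Prop :=
  ∀ (I : Submodule R R) (G : Submodule R (R × (R ⧸ I))),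
    (∀ y, (0, y) ∈ G → y = 0) → ∃ c : R ⧸ I, ∀ p ∈ G, p.2 = p.1 • c

theorem IsLeftCISemiring.cyclicBaer {R : Type u} [Ring R] (hR : IsLeftCISemiring R) :
    CyclicBaer R := by
  intro I G hG
  let i : G →ₗ[R] R := (LinearMap.fst R R (R ⧸ I)).comp G.subtype
  let f : G →ₗ[R] R ⧸ I := (LinearMap.snd R R (R ⧸ I)).comp G.subtype
  have hi : Function.Injective i := by
    rw [← LinearMap.ker_eq_bot, LinearMap.ker_eq_bot']
    rintro ⟨⟨x, y⟩, hxy⟩ h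
    obtain rfl : x = 0 := h
    obtain rfl := hG y hxy
    rfl
  obtain ⟨g, hg⟩ := hR (R ⧸ I) ⟨I.mkQ, I.mkQ_surjective⟩ G R i hi f
  refine ⟨g 1, fun p hp => ?_⟩
  rw [← g.map_smul, smul_eq_mul, mul_one]
  exact (LinearMap.congr_fun hg ⟨p, hp⟩).symm

namespace CyclicBaer

variable {R : Type u} [Ring R]

/-- Injectivity of the left ideals `R x` makes `R` von Neumann regular. -/
theorem exists_eq_mul_mul (hR : CyclicBaer R) (x : R) : ∃ z, x = x * z * x := by
  let t : R →ₗ[R] R := LinearMap.toSpanSingleton R R x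
  let I : Submodule R R := LinearMap.ker t
  obtain ⟨c, hc⟩ := hR I (LinearMap.range (t.prod I.mkQ)) (by
    rintro y ⟨r, hr⟩
    obtain ⟨h1, rfl⟩ := Prod.ext_iff.1 hr
    exact (Submodule.Quotient.mk_eq_zero I).2 h1)
  obtain ⟨z, rfl⟩ := I.mkQ_surjective c
  have h := hc _ ⟨1, rfl⟩
  simp only [LinearMap.prod_apply, Function.prod_apply] at h
  rw [← map_smul, ← sub_eq_zero, ← map_sub] at h
  have h2 : (1 - t 1 • z : R) ∈ I := (Submodule.Quotient.mk_eq_zero I).1 h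
  have h3 : (1 - x * z) * x = 0 := by simpa [I, t] using h2
  exact ⟨z, by rw [sub_mul, one_mul, sub_eq_zero] at h3; exact h3⟩

/-- The regular module itself is injective. -/
theorem exists_mul_of_graph (hR : CyclicBaer R) (G : Submodule R (R × R))
    (hG : ∀ y, (0, y) ∈ G → y = 0) : ∃ c : R, ∀ p ∈ G, p.2 = p.1 * c := by
  let q : R →ₗ[R] R ⧸ (⊥ : Submodule R R) := (⊥ : Submodule R R).mkQ
  have hq : Function.Injective q := LinearMap.ker_eq_bot.1 (Submodule.ker_mkQ ⊥)
  obtain ⟨c, hc⟩ := hR ⊥ (G.map (LinearMap.id.prodMap q)) (by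
    rintro y ⟨⟨a, b⟩, hab, h⟩
    obtain ⟨h1, rfl⟩ := Prod.ext_iff.1 h
    obtain rfl : a = 0 := h1
    simp [hG b hab])
  obtain ⟨c, rfl⟩ := (⊥ : Submodule R R).mkQ_surjective c
  refine ⟨c, fun p hp => hq ?_⟩
  exact (hc _ ⟨p, hp, rfl⟩).trans (q.map_smul p.1 c).symm

/-- If `e` is a family of orthogonal idempotents, then every subset `A` of the index set has an
element `m` that acts as an identity on the right of `e n` for `n ∈ A`, and that is killed by `e n`
for `n ∉ A`. It is the projection onto an injective hull of `⨁ n ∈ A, R e n`: if `C` is maximal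
among the left ideals that contain all `e n`, `n ∉ A`, and are disjoint from `D = ⨁ n ∈ A, R e n`,
then `D ⊕ C` is essential, and right multiplication by `m` is the identity on `D` and zero on
`C`. -/
theorem exists_separating (hR : CyclicBaer R) {ι : Type*} {e : ι → R}
    (he : ∀ n, e n * e n = e n) (ho : ∀ n k, n ≠ k → e n * e k = 0) (A : Set ι) :
    ∃ m : R, (∀ n ∈ A, e n * m = e n) ∧ ∀ n ∉ A, m * e n = 0 := by
  let D : Submodule R R := Submodule.span R (e '' A)
  have hD : ∀ n ∉ A, ∀ d ∈ D, d * e n = 0 := by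
    intro n hn d hd
    induction hd using Submodule.span_induction with
    | mem x hx =>
      obtain ⟨k, hk, rfl⟩ := hx
      exact ho k n (fun h => hn (h ▸ hk))
    | zero => simp
    | add x y _ _ hx hy => rw [add_mul, hx, hy, add_zero]
    | smul r x _ hx => rw [smul_eq_mul, mul_assoc, hx, mul_zero]
  have hD0 : ∀ d ∈ D, (∀ n ∈ A, d * e n = 0) → d = 0 := by
    intro d hd h
    obtain ⟨l, hl, rfl⟩ := (Finsupp.mem_span_image_iff_linearCombination R).1 hd
    rw [Finsupp.linearCombination_apply, Finsupp.sum] at h ⊢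
    refine Finset.sum_eq_zero fun k hk => ?_
    rw [← h k (hl hk), Finset.sum_mul, Finset.sum_eq_single k]
    · rw [smul_eq_mul, mul_assoc, he]
    · intro j _ hj
      rw [smul_eq_mul, mul_assoc, ho j k hj, mul_zero]
    · exact fun h => absurd hk h
  let C₀ : Submodule R R := Submodule.span R (e '' Aᶜ)
  have hDC₀ : Disjoint D C₀ := by
    rw [Submodule.disjoint_def]
    intro x hx hx'
    refine hD0 x hx fun n hn => ?_
    clear hx
    induction hx' using Submodule.span_induction with
    | mem x hx =>
      obtain ⟨k, hk, rfl⟩ := hx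
      exact ho k n (fun h => hk (h ▸ hn))
    | zero => simp
    | add x y _ _ hx hy => rw [add_mul, hx, hy, add_zero]
    | smul r x _ hx => rw [smul_eq_mul, mul_assoc, hx, mul_zero]
  obtain ⟨C, hC₀, hC⟩ := zorn_le_nonempty₀ {C : Submodule R R | Disjoint D C} (by
    intro c hc hchain C hCc
    refine ⟨sSup c, ?_, fun C hC => le_sSup hC⟩
    exact (DirectedOn.disjoint_sSup_right hchain.directedOn).2 fun C hC => hc hC) C₀ hDC₀
  have hess : ∀ X : Submodule R R, Disjoint (D ⊔ C) X → X = ⊥ := by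
    intro X hX
    have h1 : Disjoint D (C ⊔ X) :=
      Disjoint.disjoint_sup_right_of_disjoint_sup_left hC.prop hX
    have h2 : X ≤ C := le_sup_right.trans (hC.le_of_ge h1 le_sup_left)
    exact disjoint_self.1 (hX.mono_left (h2.trans le_sup_right))
  obtain ⟨m, hm⟩ := hR.exists_mul_of_graph
    (D.comap (LinearMap.snd R R R) ⊓ C.comap (LinearMap.fst R R R - LinearMap.snd R R R)) (by
      rintro y ⟨h1, h2⟩
      have h1 : y ∈ D := h1
      have h2 : y ∈ C := by simpa using h2
      exact Submodule.disjoint_def.1 hC.prop y h1 h2)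
  have hmD : ∀ d ∈ D, d * m = d := fun d hd => (hm (d, d) ⟨hd, by simp⟩).symm
  have hmC : ∀ x ∈ C, x * m = 0 := fun x hx => (hm (x, 0) ⟨D.zero_mem, by simpa using hx⟩).symm
  refine ⟨m, fun n hn => hmD _ (Submodule.subset_span ⟨n, hn, rfl⟩), fun n hn => ?_⟩
  -- The left annihilator of `y = m * e n` contains the essential left ideal `D ⊕ C`, and it is a
  -- direct summand of `R` since `R` is regular.
  set y := m * e n with hy
  have hann : ∀ x ∈ D ⊔ C, x * y = 0 := by
    intro x hx
    obtain ⟨d, hd, c, hc, rfl⟩ := Submodule.mem_sup.1 hx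
    rw [hy, ← mul_assoc, add_mul, hmD d hd, hmC c hc, add_zero, hD n hn d hd]
  obtain ⟨z, hz⟩ := hR.exists_eq_mul_mul y
  have h0 := hess (Submodule.span R {y * z}) (by
    rw [Submodule.disjoint_def]
    intro x hx hx'
    obtain ⟨r, rfl⟩ := Submodule.mem_span_singleton.1 hx'
    have h := hann _ hx
    rw [smul_eq_mul, mul_assoc, ← hz] at h
    rw [smul_eq_mul, ← mul_assoc, h, zero_mul])
  rw [hz, Submodule.span_singleton_eq_bot.1 h0, zero_mul]

/-- A left ideal without complement contains an infinite sequence of nonzero orthogonal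
idempotents. -/
theorem exists_orthogonal_idempotents (hR : CyclicBaer R) (L : Submodule R R)
    (hL : ¬ ∃ L', IsCompl L L') :
    ∃ e : ℕ → R, (∀ n, e n ≠ 0) ∧ (∀ n, e n * e n = e n) ∧ ∀ n k, n ≠ k → e n * e k = 0 := by
  have step : ∀ f : {f : R // f ∈ L ∧ f * f = f},
      ∃ h : R, h ∈ L ∧ h ≠ 0 ∧ h * h = h ∧ h * f = 0 ∧ f * h = 0 := by
    rintro ⟨f, hfL, hf⟩
    have hne : ∃ x ∈ L, x - x * f ≠ 0 := by
      by_contra! hcon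
      have hcon : ∀ x ∈ L, x = x * f := fun x hx => sub_eq_zero.1 (hcon x hx)
      refine hL ⟨Submodule.span R {1 - f}, ?_, ?_⟩
      · rw [Submodule.disjoint_def]
        intro x hx hx'
        obtain ⟨r, rfl⟩ := Submodule.mem_span_singleton.1 hx'
        rw [hcon _ hx, smul_eq_mul, mul_assoc, sub_mul, hf, one_mul, sub_self, mul_zero]
      · rw [codisjoint_iff, eq_top_iff]
        intro x _
        have h : x = x * f + x * (1 - f) := by rw [← mul_add, add_sub_cancel, mul_one]
        rw [h]
        exact add_mem (Submodule.mem_sup_left (L.smul_mem x hfL))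
          (Submodule.mem_sup_right (Submodule.smul_mem _ x (Submodule.mem_span_singleton_self _)))
    obtain ⟨x, hxL, hx⟩ := hne
    set y := x - x * f with hy
    have hyL : y ∈ L := L.sub_mem hxL (L.smul_mem x hfL)
    have hyf : y * f = 0 := by rw [hy, sub_mul, mul_assoc, hf, sub_self]
    obtain ⟨z, hz⟩ := hR.exists_eq_mul_mul y
    have hyh : y * ((1 - f) * z * y) = y := by
      rw [mul_assoc, ← mul_assoc, mul_sub, hyf, mul_one, sub_zero, ← mul_assoc, ← hz]
    refine ⟨(1 - f) * z * y, L.smul_mem _ hyL, fun h => hx ?_, ?_, ?_, ?_⟩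
    · rw [← hyh, h, mul_zero]
    · rw [mul_assoc ((1 - f) * z) y, hyh]
    · rw [mul_assoc, hyf, mul_zero]
    · change f * ((1 - f) * z * y) = 0
      have h1 : f * (1 - f) = 0 := by rw [mul_sub, hf, mul_one, sub_self]
      rw [← mul_assoc, ← mul_assoc, h1, zero_mul, zero_mul]
  choose h hhL hh0 hhh hhf hfh using step
  -- `F n` is the sum of the first `n` members `h (F k)`, `k < n`, of the sequence.
  let F : ℕ → {f : R // f ∈ L ∧ f * f = f} := fun n => Nat.rec ⟨0, L.zero_mem, mul_zero 0⟩
    (fun _ f => ⟨f + h f, L.add_mem f.2.1 (hhL f), by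
      rw [mul_add, add_mul, add_mul, f.2.2, hhf, hfh, hhh, add_zero, zero_add]⟩) n
  have hF : ∀ n : ℕ, (F (n + 1)).1 = (F n).1 + h (F n) := by
    intro n
    rfl
  have hlt : ∀ k n : ℕ, k < n → h (F k) * (F n).1 = h (F k) ∧ (F n).1 * h (F k) = h (F k) := by
    intro k n hkn
    induction n with
    | zero => omega
    | succ n ih =>
      rcases Nat.lt_succ_iff_lt_or_eq.1 hkn with hk | rfl
      · obtain ⟨h1, h2⟩ := ih hk
        rw [hF, mul_add, add_mul, h1, h2]
        constructor
        · rw [← h1, mul_assoc, hfh, mul_zero, add_zero]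
        · rw [← h2, ← mul_assoc, hhf, zero_mul, add_zero]
      · rw [hF, mul_add, add_mul, hhf, hfh, hhh, zero_add]
        exact ⟨rfl, rfl⟩
  refine ⟨fun n => h (F n), fun n => hh0 _, fun n => hhh _, fun n k hnk => ?_⟩
  change h (F n) * h (F k) = 0
  rcases Nat.lt_or_gt_of_ne hnk with hlt' | hlt'
  · rw [← (hlt n k hlt').1, mul_assoc, hfh, mul_zero]
  · rw [← (hlt k n hlt').2, ← mul_assoc, hhf, zero_mul]

/-- There are no infinitely many nonzero orthogonal idempotents. Index them by `ℕ × ℕ`, let `A i`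
be the `i`-th row, and let `m` be separating elements. The left ideal
`I = {x | x * e n = 0 for almost all n}` has a noninjective quotient: the homomorphism that fixes
the class of `m (A i)` for every `i`, and kills that of `m B` for every `B` meeting each row in a
finite set, does not extend. If it were multiplication by `c`, then `e n * c * e n = e n` for almost
all `n` in each row; a set `B` of such `n`, one in each row, contradicts that `e n * c * e n = 0`
for almost all `n ∈ B`. -/
theorem not_orthogonal_idempotents (hR : CyclicBaer R) {e : ℕ × ℕ → R} (h0 : ∀ n, e n ≠ 0)
    (he : ∀ n, e n * e n = e n) (ho : ∀ n k, n ≠ k → e n * e k = 0) : False := by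
  choose m hm hm' using hR.exists_separating he ho
  let I : Submodule R R :=
    { carrier := {x | {n | x * e n ≠ 0}.Finite}
      zero_mem' := by simp
      add_mem' := fun {x y} hx hy => (hx.union hy).subset fun n hn => by
        by_contra hcon
        simp only [Set.mem_union, Set.mem_ofPred_eq, not_or, not_not] at hcon
        exact hn (by rw [add_mul, hcon.1, hcon.2, add_zero])
      smul_mem' := fun r x hx => hx.subset fun n hn h => hn (by
        rw [smul_eq_mul, mul_assoc, h, mul_zero]) }
  let A : ℕ → Set (ℕ × ℕ) := fun i => {n | n.1 = i}
  let G : Submodule R (R × R) :=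
    { carrier := {p | (∃ F : Finset ℕ, ∀ n : ℕ × ℕ, n.1 ∉ F → p.2 * e n = 0) ∧
        ∀ i, {n | n ∈ A i ∧ p.1 * e n ≠ p.2 * e n}.Finite}
      zero_mem' := ⟨⟨∅, by simp⟩, by simp⟩
      add_mem' := by
        rintro p q ⟨⟨F, hF⟩, hp⟩ ⟨⟨F', hF'⟩, hq⟩
        refine ⟨⟨F ∪ F', fun n hn => ?_⟩, fun i => ?_⟩
        · rw [Finset.mem_union, not_or] at hn
          rw [Prod.snd_add, add_mul, hF n hn.1, hF' n hn.2, add_zero]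
        · refine ((hp i).union (hq i)).subset fun n hn => ?_
          by_contra hcon
          simp only [Set.mem_union, Set.mem_ofPred_eq, not_or, not_and, not_not] at hcon
          refine hn.2 ?_
          rw [Prod.fst_add, Prod.snd_add, add_mul, add_mul, hcon.1 hn.1, hcon.2 hn.1]
      smul_mem' := by
        rintro r p ⟨⟨F, hF⟩, hp⟩
        refine ⟨⟨F, fun n hn => ?_⟩, fun i => (hp i).subset fun n hn => ⟨hn.1, fun h => hn.2 ?_⟩⟩
        · rw [Prod.smul_snd, smul_eq_mul, mul_assoc, hF n hn, mul_zero]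
        · rw [Prod.smul_fst, Prod.smul_snd, smul_eq_mul, smul_eq_mul, mul_assoc, mul_assoc, h] }
  obtain ⟨c, hc⟩ := hR I (G.map (LinearMap.id.prodMap I.mkQ)) (by
    rintro y ⟨⟨a, b⟩, ⟨⟨F, hF⟩, hab⟩, h⟩
    obtain ⟨h1, rfl⟩ := Prod.ext_iff.1 h
    obtain rfl : a = 0 := h1
    refine (Submodule.Quotient.mk_eq_zero I).2 ?_
    refine (F.finite_toSet.biUnion fun i _ => hab i).subset fun n hn => ?_
    have hnF : n.1 ∈ F := by
      by_contra hcon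
      exact hn (hF n hcon)
    refine Set.mem_biUnion hnF ⟨rfl, ?_⟩
    simpa using hn.symm)
  obtain ⟨c, rfl⟩ := I.mkQ_surjective c
  have hG : ∀ p ∈ G, {n | (p.2 - p.1 * c) * e n ≠ 0}.Finite := by
    intro p hp
    have h : I.mkQ p.2 = p.1 • I.mkQ c := hc _ ⟨p, hp, rfl⟩
    rw [← map_smul, ← sub_eq_zero, ← map_sub] at h
    exact (Submodule.Quotient.mk_eq_zero I).1 h
  have hrow : ∀ i, ∃ k, e (i, k) * c * e (i, k) = e (i, k) := by
    intro i
    have hfin := hG (m (A i), m (A i))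
      ⟨⟨{i}, fun n hn => hm' _ n (by simpa [A] using hn)⟩, by simp⟩
    obtain ⟨k, hk⟩ := (hfin.preimage (f := fun k : ℕ => (i, k))
      (fun _ _ _ _ h => (Prod.ext_iff.1 h).2)).exists_notMem
    simp only [Set.mem_preimage, Set.mem_ofPred_eq, not_not] at hk
    refine ⟨k, ?_⟩
    have h1 := congrArg (e (i, k) * ·) hk
    simp only [mul_zero] at h1
    rw [← mul_assoc, mul_sub, ← mul_assoc, hm (A i) (i, k) rfl, sub_mul, he, sub_eq_zero] at h1
    exact h1.symm
  choose k hk using hrow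
  have hfin := hG (m (Set.range fun i => (i, k i)), 0) ⟨⟨∅, by simp⟩, fun i => by
    refine (Set.finite_singleton (i, k i)).subset ?_
    rintro n ⟨rfl, hn⟩
    by_contra hcon
    refine hn ?_
    rw [zero_mul]
    refine hm' _ n ?_
    rintro ⟨j, rfl⟩
    exact hcon rfl⟩
  obtain ⟨i, hi⟩ := (hfin.preimage (f := fun i : ℕ => (i, k i))
    (fun _ _ _ _ h => (Prod.ext_iff.1 h).1)).exists_notMem
  simp only [Set.mem_preimage, Set.mem_ofPred_eq, not_not, zero_sub, neg_mul, neg_eq_zero] at hi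
  refine h0 (i, k i) ?_
  have h := congrArg (e (i, k i) * ·) hi
  simp only [mul_zero] at h
  rw [← mul_assoc, ← mul_assoc, hm _ (i, k i) (Set.mem_range_self i), hk] at h
  exact h

/-- Osofsky's theorem: a ring whose cyclic left modules are injective is semisimple. -/
theorem isSemisimpleRing (hR : CyclicBaer R) : IsSemisimpleRing R := by
  refine (isSemisimpleModule_iff R R).2 ⟨fun L => ?_⟩
  by_contra hL
  obtain ⟨e, h0, he, ho⟩ := hR.exists_orthogonal_idempotents L hL
  exact hR.not_orthogonal_idempotents (e := fun n => e (Nat.pairEquiv n)) (fun n => h0 _)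
    (fun n => he _) (fun n k hnk => ho _ _ (Nat.pairEquiv.injective.ne hnk))

end CyclicBaer

/-! ### Semimodules over `Ext(R)` -/

namespace ExtSemiring

theorem zero_def {R : Type u} : (0 : ExtSemiring R) = zero := rfl

variable {R : Type u} [Ring R]

theorem one_def : (1 : ExtSemiring R) = of 1 := rfl
@[simp] theorem of_add_of (r s : R) : (of r + of s : ExtSemiring R) = of (r + s) := rfl
@[simp] theorem of_add_infty (r : R) : (of r + infty : ExtSemiring R) = infty := rfl
@[simp] theorem infty_add_infty : (infty + infty : ExtSemiring R) = infty := rfl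
@[simp] theorem of_mul_of (r s : R) : (of r * of s : ExtSemiring R) = of (r * s) := rfl
@[simp] theorem of_mul_infty (r : R) : (of r * infty : ExtSemiring R) = infty := rfl
@[simp] theorem infty_mul_of (r : R) : (infty * of r : ExtSemiring R) = infty := rfl
@[simp] theorem infty_mul_infty : (infty * infty : ExtSemiring R) = infty := rfl

section Semimodule

variable (R) {M : Type v} [AddCommMonoid M] [Module (ExtSemiring R) M]

theorem of_zero_smul_of_smul (r : R) (m : M) :
    (of 0 : ExtSemiring R) • (of r : ExtSemiring R) • m = (of 0 : ExtSemiring R) • m := by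
  rw [← mul_smul, of_mul_of, zero_mul]

theorem of_smul_of_zero_smul (r : R) (m : M) :
    (of r : ExtSemiring R) • (of 0 : ExtSemiring R) • m = (of 0 : ExtSemiring R) • m := by
  rw [← mul_smul, of_mul_of, mul_zero]

theorem infty_smul_of_smul (r : R) (m : M) :
    (infty : ExtSemiring R) • (of r : ExtSemiring R) • m = (infty : ExtSemiring R) • m := by
  rw [← mul_smul, infty_mul_of]

theorem of_smul_infty_smul (r : R) (m : M) :
    (of r : ExtSemiring R) • (infty : ExtSemiring R) • m = (infty : ExtSemiring R) • m := by
  rw [← mul_smul, of_mul_infty]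

theorem infty_smul_infty_smul (m : M) :
    (infty : ExtSemiring R) • (infty : ExtSemiring R) • m = (infty : ExtSemiring R) • m := by
  rw [← mul_smul, infty_mul_infty]

theorem of_zero_smul_add_self (m : M) :
    (of 0 : ExtSemiring R) • m + (of 0 : ExtSemiring R) • m = (of 0 : ExtSemiring R) • m := by
  rw [← add_smul, of_add_of, add_zero]

theorem infty_smul_add_self (m : M) :
    (infty : ExtSemiring R) • m + (infty : ExtSemiring R) • m = (infty : ExtSemiring R) • m := by
  rw [← add_smul, infty_add_infty]

theorem of_smul_add_infty_smul (r : R) (m : M) :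
    (of r : ExtSemiring R) • m + (infty : ExtSemiring R) • m = (infty : ExtSemiring R) • m := by
  rw [← add_smul, of_add_infty]

theorem add_infty_smul (m : M) :
    m + (infty : ExtSemiring R) • m = (infty : ExtSemiring R) • m := by
  simpa only [← one_def, one_smul] using of_smul_add_infty_smul R 1 m

theorem add_of_zero_smul (m : M) : m + (of 0 : ExtSemiring R) • m = m := by
  conv_lhs => rw [← one_smul (ExtSemiring R) m, one_def, ← mul_smul, ← add_smul, of_mul_of,
    of_add_of, zero_mul, add_zero, ← one_def, one_smul]

end Semimodule

end ExtSemiring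

/-- The `Ext(R)`-semimodule `N ∪ {0, ∞}` of an `R`-module `N`, where `0` and `∞` are new. It is
defined separately from `ExtSemiring`, whose operations need a ring structure on `N`. -/
inductive ExtModule (N : Type v) : Type v
  | zero : ExtModule N
  | of (n : N) : ExtModule N
  | infty : ExtModule N

namespace ExtModule

open ExtSemiring (of_zero_smul_of_smul of_smul_of_zero_smul infty_smul_of_smul of_smul_infty_smul
  infty_smul_infty_smul of_zero_smul_add_self infty_smul_add_self add_infty_smul)

instance {N : Type v} : Zero (ExtModule N) := ⟨zero⟩

theorem zero_def {N : Type v} : (0 : ExtModule N) = zero := rfl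

variable {R : Type u} [Ring R] {N : Type v} [AddCommGroup N] [Module R N]

/-- The addition of `N`, with `0` neutral and `∞` absorbing. -/
def add : ExtModule N → ExtModule N → ExtModule N
  | zero, y => y
  | x, zero => x
  | of r, of s => of (r + s)
  | _, _ => infty

/-- The action of `R` on `N`, with `s 0 = 0 x = 0`, and `∞` as the value in all other cases. -/
def smul : ExtSemiring R → ExtModule N → ExtModule N
  | .zero, _ => zero
  | _, zero => zero
  | .of r, of n => of (r • n)
  | _, _ => infty

instance : Add (ExtModule N) := ⟨add⟩

instance : AddCommMonoid (ExtModule N) where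
  add_assoc x y z := by
    change add (add x y) z = add x (add y z)
    cases x <;> cases y <;> cases z <;> simp [add, add_assoc]
  zero_add x := by
    change add zero x = x
    cases x <;> rfl
  add_zero x := by
    change add x zero = x
    cases x <;> rfl
  add_comm x y := by
    change add x y = add y x
    cases x <;> cases y <;> simp [add, add_comm]
  nsmul := nsmulRec

instance : Module (ExtSemiring R) (ExtModule N) where
  smul := smul
  one_smul x := by
    change smul (.of (1 : R)) x = x
    cases x <;> simp [smul]
  mul_smul r s x := by
    change smul (ExtSemiring.mul r s) x = smul r (smul s x)
    cases r <;> cases s <;> cases x <;> simp [smul, ExtSemiring.mul, mul_smul]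
  smul_zero r := by
    change smul r zero = zero
    cases r <;> rfl
  smul_add r x y := by
    change smul r (add x y) = add (smul r x) (smul r y)
    cases r <;> cases x <;> cases y <;> simp [smul, add]
  add_smul r s x := by
    change smul (ExtSemiring.add r s) x = add (smul r x) (smul s x)
    cases r <;> cases s <;> cases x <;> simp [smul, ExtSemiring.add, add, add_smul]
  zero_smul x := by
    change smul (.zero : ExtSemiring R) x = zero
    cases x <;> rfl

@[simp] theorem of_add_of (m n : N) : (of m + of n : ExtModule N) = of (m + n) := rfl
@[simp] theorem add_infty (x : ExtModule N) : x + infty = infty := by cases x <;> rfl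
@[simp] theorem infty_add (x : ExtModule N) : infty + x = infty := by cases x <;> rfl
@[simp] theorem of_smul_of (r : R) (n : N) :
    (ExtSemiring.of r • of n : ExtModule N) = of (r • n) := rfl
@[simp] theorem of_smul_infty (r : R) :
    (ExtSemiring.of r • infty : ExtModule N) = infty := rfl
@[simp] theorem infty_smul_of (n : N) :
    ((ExtSemiring.infty : ExtSemiring R) • of n : ExtModule N) = infty := rfl
@[simp] theorem infty_smul_infty :
    ((ExtSemiring.infty : ExtSemiring R) • infty : ExtModule N) = infty := rfl

/-- The map `N ∪ {0, ∞} → N` that is the identity on `N`; the new zero and, as a junk value, `∞` are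
mapped to the zero of `N`. -/
def val : ExtModule N → N
  | zero => 0
  | of n => n
  | infty => 0

@[simp] theorem val_zero : val (0 : ExtModule N) = 0 := rfl
@[simp] theorem val_of (n : N) : val (of n) = n := rfl

theorem val_add {x y : ExtModule N} (hx : x ≠ infty) (hy : y ≠ infty) :
    val (x + y) = val x + val y := by
  cases x <;> cases y <;> simp_all [← zero_def]

theorem add_ne_infty {x y : ExtModule N} (hx : x ≠ infty) (hy : y ≠ infty) :
    x + y ≠ infty := by
  cases x <;> cases y <;> simp_all [← zero_def]

theorem val_of_smul (r : R) (x : ExtModule N) :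
    val ((ExtSemiring.of r : ExtSemiring R) • x) = r • val x := by
  cases x with
  | zero => rw [← zero_def, smul_zero, val_zero, smul_zero]
  | of n => rfl
  | infty => exact (smul_zero r).symm

theorem of_smul_ne_infty (r : R) {x : ExtModule N} (hx : x ≠ infty) :
    (ExtSemiring.of r : ExtSemiring R) • x ≠ infty := by
  cases x <;> simp_all [← zero_def]

/-- Functoriality of `N ↦ N ∪ {0, ∞}`. -/
def map {P : Type w} [AddCommGroup P] [Module R P] (f : N →ₗ[R] P) :
    ExtModule N →ₗ[ExtSemiring R] ExtModule P where
  toFun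
    | zero => zero
    | of n => of (f n)
    | infty => infty
  map_add' x y := by
    cases x <;> cases y <;> simp [← zero_def]
  map_smul' r x := by
    cases r <;> cases x <;> simp [← zero_def, ← ExtSemiring.zero_def]

theorem map_injective {P : Type w} [AddCommGroup P] [Module R P] {f : N →ₗ[R] P}
    (hf : Function.Injective f) : Function.Injective (map f) := by
  intro x y h
  cases x <;> cases y <;> simp_all [map, hf.eq_iff]

/-! ### The module of elements below a set of idempotents -/

section Localization

variable {B : Type w} [AddCommMonoid B] [Module (ExtSemiring R) B]
  (D : AddSubmonoid B)

variable (R) in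
/-- The elements `b` of an `Ext(R)`-semimodule whose additive idempotent `0_R • b` lies below an
element of the submonoid `D`. -/
def below : AddSubmonoid B where
  carrier := {b | ∃ d ∈ D, (ExtSemiring.of 0 : ExtSemiring R) • b + d = d}
  zero_mem' := ⟨0, D.zero_mem, by simp⟩
  add_mem' := by
    rintro b b' ⟨d, hd, h⟩ ⟨d', hd', h'⟩
    exact ⟨d + d', D.add_mem hd hd', by rw [smul_add, add_add_add_comm, h, h']⟩

theorem mem_below_add_left {b b' : B} (h : b + b' ∈ below R D) : b ∈ below R D := by
  obtain ⟨d, hd, h⟩ := h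
  refine ⟨d, hd, ?_⟩
  conv_lhs => rw [← h, smul_add, ← add_assoc, ← add_assoc, of_zero_smul_add_self, ← smul_add, h]

theorem add_mem_below_iff {b b' : B} :
    b + b' ∈ below R D ↔ b ∈ below R D ∧ b' ∈ below R D :=
  ⟨fun h => ⟨mem_below_add_left D h, mem_below_add_left D (by rwa [add_comm])⟩,
    fun h => add_mem h.1 h.2⟩

theorem of_smul_mem_below_iff (r : R) {b : B} :
    (ExtSemiring.of r : ExtSemiring R) • b ∈ below R D ↔ b ∈ below R D := by
  change (∃ d ∈ D, _) ↔ ∃ d ∈ D, _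
  simp only [of_zero_smul_of_smul]

variable (R) in
/-- Elements of `below R D` are identified if they become equal after adding an element of `D`. If
`D` consists of additive idempotents, the quotient is the direct limit of the `R`-modules
`{b | 0_R • b = d}` over `d ∈ D`. -/
def belowCon : AddCon (below R D) where
  r x y := ∃ d ∈ D, (x : B) + d = y + d
  iseqv :=
    { refl := fun _ => ⟨0, D.zero_mem, rfl⟩
      symm := fun ⟨d, hd, h⟩ => ⟨d, hd, h.symm⟩
      trans := fun {x y z} ⟨d, hd, h⟩ ⟨d', hd', h'⟩ => ⟨d + d', D.add_mem hd hd', by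
        rw [← add_assoc, h, add_right_comm, h', add_right_comm, add_assoc]⟩ }
  add' := fun {x x' y y'} ⟨d, hd, h⟩ ⟨d', hd', h'⟩ => ⟨d + d', D.add_mem hd hd', by
    rw [AddSubmonoid.coe_add, AddSubmonoid.coe_add, add_add_add_comm, h, h', add_add_add_comm]⟩

/-- The action of `r : R` on `below R D`, as an additive map. -/
def belowSMul (r : R) : below R D →+ below R D where
  toFun b := ⟨(ExtSemiring.of r : ExtSemiring R) • (b : B), (of_smul_mem_below_iff D r).2 b.2⟩
  map_zero' := Subtype.ext (smul_zero _)
  map_add' b b' := Subtype.ext (smul_add (ExtSemiring.of r : ExtSemiring R) (b : B) (b' : B))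

variable (hD : ∀ d ∈ D, (ExtSemiring.of 0 : ExtSemiring R) • d = d)

include hD in
theorem of_smul_eq_self {d : B} (hd : d ∈ D) (r : R) :
    (ExtSemiring.of r : ExtSemiring R) • d = d := by
  rw [← hD d hd, of_smul_of_zero_smul]

/-- The `R`-module structure on the direct limit. -/
@[reducible] def belowModule : Module R (belowCon R D).Quotient where
  smul r := (belowCon R D).lift ((belowCon R D).mk'.comp (belowSMul D r)) (by
    rintro x y ⟨d, hd, h⟩
    refine ((belowCon R D).eq).2 ⟨d, hd, ?_⟩
    change (ExtSemiring.of r : ExtSemiring R) • (x : B) + d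
      = (ExtSemiring.of r : ExtSemiring R) • (y : B) + d
    rw [← of_smul_eq_self D hD hd r, ← smul_add, h, smul_add])
  one_smul x := by
    induction x using AddCon.induction_on with | _ b =>
    exact congrArg (belowCon R D).mk' (Subtype.ext (one_smul (ExtSemiring R) (b : B)))
  mul_smul r s x := by
    induction x using AddCon.induction_on with | _ b =>
    exact congrArg (belowCon R D).mk' (Subtype.ext
      (mul_smul (ExtSemiring.of r : ExtSemiring R) (ExtSemiring.of s) (b : B)))
  smul_zero r := map_zero _
  smul_add r x y := map_add _ x y
  add_smul r s x := by
    induction x using AddCon.induction_on with | _ b =>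
    exact congrArg (belowCon R D).mk' (Subtype.ext
      (add_smul (ExtSemiring.of r : ExtSemiring R) (ExtSemiring.of s) (b : B)))
  zero_smul x := by
    induction x using AddCon.induction_on with | _ b =>
    obtain ⟨d, hd, h⟩ := b.2
    refine ((belowCon R D).eq).2 ⟨d, hd, ?_⟩
    change (ExtSemiring.of 0 : ExtSemiring R) • (b : B) + d = 0 + d
    rw [h, zero_add]

end Localization

/-! ### Injectivity of semimodules over `Ext(R)` -/

/-- Let `f : A → N ∪ {0, ∞}` be a homomorphism, `i : A → B` injective, and let `D` be the set of
`0_R • i a` with `f a ≠ ∞`. Then `f` induces a homomorphism to `N` from the submodule of classes of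
`i a` with `f a ≠ ∞` in the direct limit of the `R`-modules below `D`; it extends to the whole
direct limit. -/
theorem exists_extend_below [IsSemisimpleRing R] {A B : Type v} [AddCommMonoid A]
    [AddCommMonoid B] [Module (ExtSemiring R) A] [Module (ExtSemiring R) B]
    (i : A →ₗ[ExtSemiring R] B) (hi : Function.Injective i)
    (f : A →ₗ[ExtSemiring R] ExtModule N) (D : AddSubmonoid B)
    (hD : ∀ b, b ∈ D ↔ ∃ a, f a ≠ infty ∧ i ((ExtSemiring.of 0 : ExtSemiring R) • a) = b) :
    ∃ h : below R D →+ N,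
      (∀ b c : below R D, ∀ d ∈ D, (b : B) + d = c + d → h b = h c) ∧
      (∀ r b, h (belowSMul D r b) = r • h b) ∧
      ∀ a, f a ≠ infty → ∀ ha : i a ∈ below R D, h ⟨i a, ha⟩ = val (f a) := by
  have hD' : ∀ d ∈ D, (ExtSemiring.of 0 : ExtSemiring R) • d = d := by
    intro d hd
    obtain ⟨a, -, rfl⟩ := (hD d).1 hd
    rw [← i.map_smul, of_smul_of_zero_smul]
  let _ : Module R (belowCon R D).Quotient := belowModule D hD'
  let _ : AddCommGroup (belowCon R D).Quotient := Module.addCommMonoidToAddCommGroup R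
  have hmk_smul : ∀ (r : R) (b : below R D),
      r • (belowCon R D).mk' b = (belowCon R D).mk' (belowSMul D r b) := fun _ _ => rfl
  let G : Submodule R ((belowCon R D).Quotient × N) :=
    { carrier := {p | ∃ a, f a ≠ infty ∧ ∃ ha : i a ∈ below R D,
        (belowCon R D).mk' ⟨i a, ha⟩ = p.1 ∧ val (f a) = p.2}
      zero_mem' := ⟨0, by simp [zero_def], by simp, by
        refine ⟨?_, by simp⟩
        exact (congrArg (belowCon R D).mk' (Subtype.ext i.map_zero)).trans
          (map_zero (belowCon R D).mk')⟩
      add_mem' := by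
        rintro ⟨x, m⟩ ⟨y, n⟩ ⟨a, h1, h2, rfl, rfl⟩ ⟨b, h3, h4, rfl, rfl⟩
        refine ⟨a + b, by rw [map_add]; exact add_ne_infty h1 h3,
          by rw [map_add]; exact add_mem h2 h4, ?_, ?_⟩
        · exact (congrArg (belowCon R D).mk' (Subtype.ext (i.map_add a b))).trans
            (map_add (belowCon R D).mk' ⟨i a, h2⟩ ⟨i b, h4⟩)
        · rw [map_add, val_add h1 h3]; rfl
      smul_mem' := by
        rintro r ⟨x, m⟩ ⟨a, h1, h2, rfl, rfl⟩
        refine ⟨(ExtSemiring.of r : ExtSemiring R) • a,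
          by rw [f.map_smul]; exact of_smul_ne_infty r h1,
          by rw [i.map_smul]; exact (of_smul_mem_below_iff D r).2 h2, ?_, ?_⟩
        · rw [Prod.smul_fst, hmk_smul]
          exact congrArg _ (Subtype.ext (i.map_smul _ a))
        · rw [f.map_smul, val_of_smul]; rfl }
  have hG : ∀ y, (0, y) ∈ G → y = 0 := by
    rintro y ⟨a, h1, h2, h3, rfl⟩
    rw [← map_zero (belowCon R D).mk'] at h3
    obtain ⟨d, hd, h⟩ := ((belowCon R D).eq).1 h3
    obtain ⟨c, hc, rfl⟩ := (hD d).1 hd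
    have h : i a + i ((ExtSemiring.of 0 : ExtSemiring R) • c)
        = 0 + i ((ExtSemiring.of 0 : ExtSemiring R) • c) := h
    rw [zero_add, ← map_add] at h
    have h4 := congrArg (fun a => val (f a)) (hi h)
    simp only [map_add, map_smul] at h4
    rw [val_add h1 (of_smul_ne_infty 0 hc)] at h4
    exact add_eq_right.1 h4
  have hinj : Function.Injective ((LinearMap.fst R _ N).comp G.subtype) := by
    rw [← LinearMap.ker_eq_bot, LinearMap.ker_eq_bot']
    rintro ⟨⟨x, y⟩, hxy⟩ h
    obtain rfl : x = 0 := h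
    obtain rfl := hG y hxy
    rfl
  obtain ⟨h, hh⟩ := (Module.injective_of_isSemisimpleRing R N).out
    ((LinearMap.fst R _ N).comp G.subtype) hinj ((LinearMap.snd R _ N).comp G.subtype)
  refine ⟨h.toAddMonoidHom.comp (belowCon R D).mk', fun b c d hd hbc => ?_, fun r b => ?_,
    fun a h1 ha => ?_⟩
  · exact congrArg h (((belowCon R D).eq).2 ⟨d, hd, hbc⟩)
  · exact h.map_smul r ((belowCon R D).mk' b)
  · exact hh ⟨((belowCon R D).mk' ⟨i a, ha⟩, val (f a)), a, h1, ha, rfl, rfl⟩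

/-- Over `Ext(R)` with `R` semisimple, all semimodules `N ∪ {0, ∞}` are injective. An extension of
`f : A → N ∪ {0, ∞}` along `A ⊆ B` has value `0` at the `b` for which `∞ • b` lies below some
`0_R • a` with `f a ≠ ∞`; on the other elements `b` with `0_R • b` below some such `0_R • a` it has
values in `N`, and it is `∞` elsewhere. -/
theorem isInjectiveSemimodule [IsSemisimpleRing R] :
    IsInjectiveSemimodule (ExtSemiring R) (ExtModule N) := by
  classical
  intro A B _ _ _ _ i hi f
  let e : ExtSemiring R := ExtSemiring.of 0
  let w : ExtSemiring R := ExtSemiring.infty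
  let D : AddSubmonoid B :=
    { carrier := {b | ∃ a, f a ≠ infty ∧ i (e • a) = b}
      zero_mem' := ⟨0, by simp [zero_def], by simp⟩
      add_mem' := by
        rintro _ _ ⟨a, h1, rfl⟩ ⟨b, h2, rfl⟩
        exact ⟨a + b, by rw [map_add]; exact add_ne_infty h1 h2, by rw [smul_add, map_add]⟩ }
  obtain ⟨h, hcongr, hsmul, hext⟩ := exists_extend_below i hi f D (fun _ => Iff.rfl)
  let Z : B → Prop := fun b => w • b ∈ below R D
  have hZ : ∀ b, Z b ↔ ∃ d ∈ D, w • b + d = d := by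
    intro b
    change (∃ d ∈ D, _) ↔ _
    simp only [w, of_smul_infty_smul]
  have hZb : ∀ b, Z b → b ∈ below R D := by
    intro b hb
    refine mem_below_add_left D (b' := w • b) ?_
    rwa [add_infty_smul]
  have hZadd : ∀ b b', Z (b + b') ↔ Z b ∧ Z b' := fun b b' => by
    change w • (b + b') ∈ _ ↔ _
    rw [smul_add, add_mem_below_iff]
  have hZof : ∀ (r : R) b, Z ((ExtSemiring.of r : ExtSemiring R) • b) ↔ Z b := fun r b => by
    change w • _ ∈ _ ↔ w • b ∈ _
    rw [infty_smul_of_smul]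
  have hZw : ∀ b, Z (w • b) ↔ Z b := fun b => by
    change w • w • b ∈ _ ↔ w • b ∈ _
    rw [infty_smul_infty_smul]
  have hZ0 : ∀ b (hb : b ∈ below R D), Z b → h ⟨b, hb⟩ = 0 := by
    intro b hb hZb
    obtain ⟨d, hd, hbd⟩ := (hZ b).1 hZb
    rw [← map_zero h]
    refine hcongr _ _ d hd ?_
    change b + d = 0 + d
    conv_lhs => rw [← hbd, ← add_assoc, add_infty_smul, hbd]
    rw [zero_add]
  let g : B → ExtModule N := fun b =>
    if Z b then 0 else if hb : b ∈ below R D then of (h ⟨b, hb⟩) else infty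
  have hgZ : ∀ b, Z b → g b = 0 := fun b hb => if_pos hb
  have hgK : ∀ b, ¬ Z b → ∀ hb : b ∈ below R D, g b = of (h ⟨b, hb⟩) := fun b hb hb' => by
    simp [g, hb, hb']
  have hgI : ∀ b, b ∉ below R D → g b = infty := fun b hb => by
    have hb' : ¬ Z b := fun h => hb (hZb b h)
    simp [g, hb, hb']
  have hne : ∀ b, b ∈ below R D → g b ≠ infty ∧ ∀ hb : b ∈ below R D, val (g b) = h ⟨b, hb⟩ := by
    intro b hb
    by_cases hZ : Z b
    · rw [hgZ b hZ]
      exact ⟨by simp [zero_def], fun hb => by rw [hZ0 b hb hZ]; rfl⟩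
    · rw [hgK b hZ hb]
      exact ⟨by simp, fun _ => rfl⟩
  refine ⟨{ toFun := g, map_add' := fun b b' => ?_, map_smul' := fun s b => ?_ }, ?_⟩
  · by_cases hb : b ∈ below R D
    swap
    · rw [hgI b hb, hgI _ (fun h => hb ((add_mem_below_iff D).1 h).1), infty_add]
    by_cases hb' : b' ∈ below R D
    swap
    · rw [hgI b' hb', hgI _ (fun h => hb' ((add_mem_below_iff D).1 h).2), add_infty]
    have hbb := add_mem hb hb'
    have hadd : h ⟨b + b', hbb⟩ = h ⟨b, hb⟩ + h ⟨b', hb'⟩ := by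
      rw [← map_add]; rfl
    by_cases h1 : Z b
    · by_cases h2 : Z b'
      · rw [hgZ b h1, hgZ b' h2, hgZ _ ((hZadd b b').2 ⟨h1, h2⟩), add_zero]
      · rw [hgZ b h1, hgK b' h2 hb', hgK _ (fun h => h2 ((hZadd b b').1 h).2) hbb, hadd,
          hZ0 b hb h1, zero_add, zero_add]
    · rw [hgK _ (fun h => h1 ((hZadd b b').1 h).1) hbb, hgK b h1 hb, hadd]
      by_cases h2 : Z b'
      · rw [hgZ b' h2, hZ0 b' hb' h2, add_zero, add_zero]
      · rw [hgK b' h2 hb', of_add_of]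
  · rw [RingHom.id_apply]
    cases s with
    | zero =>
      rw [← ExtSemiring.zero_def, zero_smul, zero_smul]
      exact hgZ 0 ((hZ 0).2 ⟨0, D.zero_mem, by simp⟩)
    | of r =>
      by_cases h1 : Z b
      · rw [hgZ b h1, hgZ _ ((hZof r b).2 h1), smul_zero]
      by_cases hb : b ∈ below R D
      · rw [hgK b h1 hb, hgK _ (fun h => h1 ((hZof r b).1 h)) ((of_smul_mem_below_iff D r).2 hb),
          of_smul_of, ← hsmul]
        rfl
      · rw [hgI b hb, hgI _ (fun h => hb ((of_smul_mem_below_iff D r).1 h)), of_smul_infty]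
    | infty =>
      by_cases h1 : Z b
      · rw [hgZ b h1, hgZ _ ((hZw b).2 h1), smul_zero]
      rw [hgI _ (fun h => h1 h)]
      by_cases hb : b ∈ below R D
      · rw [hgK b h1 hb, infty_smul_of]
      · rw [hgI b hb, infty_smul_infty]
  · ext a
    change g (i a) = f a
    have hw : w • f a = infty → ¬ Z (i a) := by
      intro hfa hZa
      obtain ⟨_, ⟨c, hc, rfl⟩, hd⟩ := (hZ _).1 hZa
      rw [← i.map_smul, ← map_add] at hd
      have h1 := congrArg f (hi hd)
      rw [map_add, f.map_smul, hfa, infty_add, f.map_smul] at h1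
      exact of_smul_ne_infty 0 hc h1.symm
    have hmem : f a ≠ infty → i a ∈ below R D := fun ha => ⟨i (e • a), ⟨a, ha, rfl⟩, by
      rw [← i.map_smul, ← map_add, of_zero_smul_add_self]⟩
    cases hfa : f a with
    | zero =>
      refine hgZ _ ((hZ _).2 ⟨i (e • w • a), ⟨w • a, ?_, rfl⟩, ?_⟩)
      · rw [f.map_smul, hfa, ← zero_def, smul_zero]
        simp [zero_def]
      · rw [of_smul_infty_smul, ← i.map_smul, ← map_add, infty_smul_add_self]
    | of n =>
      have hne : f a ≠ infty := by simp [hfa]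
      rw [hgK _ (hw (by rw [hfa]; rfl)) (hmem hne), hext a hne, hfa, val_of]
    | infty =>
      refine hgI _ ?_
      rintro ⟨_, ⟨c, hc, rfl⟩, hd⟩
      rw [← i.map_smul, ← map_add] at hd
      have h1 := congrArg f (hi hd)
      rw [map_add, f.map_smul, hfa, of_smul_infty, infty_add, f.map_smul] at h1
      exact of_smul_ne_infty 0 hc h1.symm

end ExtModule

/-- A two-element semimodule `{0, m₀}` with `m₀ + m₀ = m₀`, on which all nonzero scalars act as the
identity, is injective if the semiring has an element `w` with `1 + w = w + w = w` and `w s = w` for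
all `s ≠ 0`: a homomorphism extends by the value `0` at those `b` for which `w • b` lies below some
`w • a` in the kernel. -/
theorem isInjectiveSemimodule_of_two_elements {S : Type u} [Semiring S] {M : Type v}
    [AddCommMonoid M] [Module S M] (w : S) (h1w : 1 + w = w) (hww : w + w = w)
    (hws : ∀ s, s ≠ 0 → w * s = w) (m₀ : M) (hM : ∀ m, m = 0 ∨ m = m₀)
    (hadd : m₀ + m₀ = m₀) (hs : ∀ s : S, s ≠ 0 → s • m₀ = m₀) : IsInjectiveSemimodule S M := by
  classical
  intro A B _ _ _ _ i hi f
  let P : B → Prop := fun b => ∃ a, f a = 0 ∧ w • b + w • i a = w • i a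
  have hPadd1 : ∀ b b', P (b + b') → P b := by
    rintro b b' ⟨a, ha, h⟩
    refine ⟨a, ha, ?_⟩
    conv_lhs => rw [← h, smul_add, ← add_assoc, ← add_assoc, ← add_smul, hww, ← smul_add, h]
  have hPadd : ∀ b b', P (b + b') ↔ P b ∧ P b' := by
    refine fun b b' => ⟨fun h => ⟨hPadd1 b b' h, hPadd1 b' b (by rwa [add_comm])⟩, ?_⟩
    rintro ⟨⟨a, ha, h⟩, ⟨a', ha', h'⟩⟩
    refine ⟨a + a', by rw [map_add, ha, ha', add_zero], ?_⟩
    rw [map_add, smul_add, smul_add, add_add_add_comm, h, h']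
  have hPsmul : ∀ (s : S) (b : B), s ≠ 0 → (P (s • b) ↔ P b) := by
    intro s b hs0
    simp only [P, ← mul_smul, hws s hs0]
  let g : B → M := fun b => if P b then 0 else m₀
  refine ⟨{ toFun := g, map_add' := fun b b' => ?_, map_smul' := fun s b => ?_ }, ?_⟩
  · by_cases h : P b <;> by_cases h' : P b' <;> simp [g, hPadd, h, h', hadd]
  · rw [RingHom.id_apply]
    by_cases hs0 : s = 0
    · subst hs0
      rw [zero_smul, zero_smul]
      exact if_pos ⟨0, map_zero f, by simp⟩
    · by_cases h : P b <;> simp [g, hPsmul s b hs0, h, hs s hs0]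
  · ext a
    change g (i a) = f a
    by_cases ha : f a = 0
    · rw [ha]
      exact if_pos ⟨a, ha, by rw [← add_smul, hww]⟩
    · refine (if_neg ?_).trans ((hM (f a)).resolve_left ha).symm
      rintro ⟨c, hc, h⟩
      rw [← i.map_smul, ← i.map_smul, ← map_add] at h
      have h1 := congrArg f (hi h)
      rw [map_add, f.map_smul, f.map_smul, hc, smul_zero, add_zero] at h1
      refine ha ?_
      rw [← one_smul S (f a), ← add_zero ((1 : S) • f a), ← h1, ← add_smul, h1w]

/-! ### The left CI-semirings of the classification -/

theorem isLeftCISemiring_of_isSemisimpleRing {R : Type u} [Ring R] [IsSemisimpleRing R] :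
    IsLeftCISemiring R := by
  intro M _ _ _ A B _ _ _ _ i hi f
  let _ : AddCommGroup M := Module.addCommMonoidToAddCommGroup R
  let _ : AddCommGroup A := Module.addCommMonoidToAddCommGroup R
  let _ : AddCommGroup B := Module.addCommMonoidToAddCommGroup R
  obtain ⟨g, hg⟩ := (Module.injective_of_isSemisimpleRing R M).out i hi f
  exact ⟨g, LinearMap.ext hg⟩

theorem isLeftCISemiring_of_equiv_boolean {T : Type u} [Semiring T] (e : T ≃+* BooleanSemiring) :
    IsLeftCISemiring T := by
  have h2 : ∀ t : T, t = 0 ∨ t = 1 := by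
    intro t
    have h : ∀ b : BooleanSemiring, b = 0 ∨ b = 1 := by decide
    exact (h (e t)).imp (fun h => by simpa using h) (fun h => by simpa using h)
  have h11 : (1 : T) + 1 = 1 := e.injective (by simp only [map_add, map_one]; decide)
  intro M _ _ ⟨p, hp⟩
  have hM : ∀ m, m = 0 ∨ m = p 1 := by
    intro m
    obtain ⟨t, rfl⟩ := hp m
    rcases h2 t with rfl | rfl
    · exact .inl (map_zero p)
    · exact .inr rfl
  by_cases h0 : p 1 = 0
  · have : Subsingleton M := subsingleton_of_forall_eq 0 fun m => (hM m).elim id fun h => h.trans h0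
    exact isInjectiveSemimodule_of_subsingleton
  · have hs : ∀ s : T, s ≠ 0 → s = 1 := fun s hs => (h2 s).resolve_left hs
    refine isInjectiveSemimodule_of_two_elements 1 h11 h11 (fun s h => by rw [hs s h, mul_one])
      (p 1) hM (by rw [← map_add, h11]) fun s h => by rw [hs s h, one_smul]

namespace ExtSemiring

variable {R : Type u} [Ring R]

/-- A cyclic semimodule over `Ext(R)`, generated by `m₀`, is zero if `∞ m₀ = 0`, has two elements if
`∞ m₀ = 0_R m₀ ≠ 0`, and is otherwise isomorphic to `(R ⧸ I) ∪ {0, ∞}` for the left ideal `I` of all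
`r` with `r m₀ = 0_R m₀`. -/
theorem isLeftCISemiring [IsSemisimpleRing R] : IsLeftCISemiring (ExtSemiring R) := by
  intro M _ _ ⟨p, hp⟩
  set m₀ : M := p 1 with hm₀
  have hgen : ∀ m, ∃ s : ExtSemiring R, s • m₀ = m := by
    intro m
    obtain ⟨s, rfl⟩ := hp m
    exact ⟨s, by rw [hm₀, ← map_smul, smul_eq_mul, mul_one]⟩
  by_cases h0 : (infty : ExtSemiring R) • m₀ = 0
  · have h1 : m₀ = 0 := by rw [← add_zero m₀, ← h0, add_infty_smul]
    have : Subsingleton M := subsingleton_of_forall_eq 0 fun m => by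
      obtain ⟨s, rfl⟩ := hgen m
      rw [h1, smul_zero]
    exact isInjectiveSemimodule_of_subsingleton
  by_cases he : (infty : ExtSemiring R) • m₀ = (of 0 : ExtSemiring R) • m₀
  · have h1 : (infty : ExtSemiring R) • m₀ = m₀ := by
      conv_rhs => rw [← add_of_zero_smul R m₀, ← he, add_infty_smul]
    have hs : ∀ s : ExtSemiring R, s ≠ 0 → s • m₀ = m₀ := by
      intro s hs
      cases s with
      | zero => exact absurd rfl hs
      | of r => rw [← h1, of_smul_infty_smul]
      | infty => exact h1
    refine isInjectiveSemimodule_of_two_elements infty rfl rfl ?_ m₀ (fun m => ?_)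
      (by conv_lhs => rw [← h1, infty_smul_add_self, h1]) hs
    · intro s hs
      cases s with
      | zero => exact absurd rfl hs
      | of r => rfl
      | infty => rfl
    · obtain ⟨s, rfl⟩ := hgen m
      by_cases h : s = 0
      · exact .inl (by rw [h, zero_smul])
      · exact .inr (hs s h)
  let I : Submodule R R :=
    { carrier := {r | (of r : ExtSemiring R) • m₀ = (of 0 : ExtSemiring R) • m₀}
      zero_mem' := rfl
      add_mem' := fun {r s} hr hs => by
        change (of (r + s) : ExtSemiring R) • m₀ = _
        rw [← of_add_of, add_smul, show _ • m₀ = _ from hr, show _ • m₀ = _ from hs,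
          of_zero_smul_add_self]
      smul_mem' := fun s r hr => by
        change (of (s * r) : ExtSemiring R) • m₀ = _
        rw [← of_mul_of, mul_smul, show (of r : ExtSemiring R) • m₀ = _ from hr,
          of_smul_of_zero_smul] }
  have hI : ∀ r s, I.mkQ r = I.mkQ s ↔
      (of r : ExtSemiring R) • m₀ = (of s : ExtSemiring R) • m₀ := by
    intro r s
    rw [← sub_eq_zero, ← map_sub]
    have hmem : I.mkQ (r - s) = 0 ↔
        (of (r - s) : ExtSemiring R) • m₀ = (of 0 : ExtSemiring R) • m₀ :=
      Submodule.Quotient.mk_eq_zero I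
    rw [hmem]
    constructor
    · intro h
      rw [← sub_add_cancel r s, ← of_add_of, add_smul, h, ← add_smul, of_add_of, zero_add]
    · intro h
      rw [sub_eq_add_neg, ← of_add_of, add_smul, h, ← add_smul, of_add_of, add_neg_cancel]
  let out : R ⧸ I → R := Function.surjInv I.mkQ_surjective
  have hout : ∀ q, I.mkQ (out q) = q := Function.surjInv_eq I.mkQ_surjective
  let F : ExtModule (R ⧸ I) →ₗ[ExtSemiring R] M :=
    { toFun := fun
        | .zero => 0
        | .of q => (of (out q) : ExtSemiring R) • m₀
        | .infty => (infty : ExtSemiring R) • m₀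
      map_add' := fun x y => by
        cases x with
        | zero => exact (zero_add _).symm
        | of q =>
          cases y with
          | zero => exact (add_zero _).symm
          | of q' =>
            change (of (out (q + q')) : ExtSemiring R) • m₀
              = (of (out q) : ExtSemiring R) • m₀ + (of (out q') : ExtSemiring R) • m₀
            rw [← add_smul, of_add_of, ← hI, map_add, hout, hout, hout]
          | infty => exact (of_smul_add_infty_smul R _ m₀).symm
        | infty =>
          cases y with
          | zero => exact (add_zero _).symm
          | of q' => exact ((add_comm _ _).trans (of_smul_add_infty_smul R _ m₀)).symm
          | infty => exact (infty_smul_add_self R m₀).symm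
      map_smul' := fun s x => by
        cases x with
        | zero => cases s <;> exact (smul_zero _).symm
        | of q =>
          cases s with
          | zero => exact (zero_smul (ExtSemiring R) _).symm
          | of r =>
            change (of (out (r • q)) : ExtSemiring R) • m₀
              = (of r : ExtSemiring R) • (of (out q) : ExtSemiring R) • m₀
            rw [← mul_smul, of_mul_of, ← hI, hout, ← smul_eq_mul, map_smul, hout]
          | infty => exact (infty_smul_of_smul R _ m₀).symm
        | infty =>
          cases s with
          | zero => exact (zero_smul (ExtSemiring R) _).symm
          | of r => exact (of_smul_infty_smul R _ m₀).symm
          | infty => exact (infty_smul_infty_smul R m₀).symm }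
  have hF0 : F .zero = 0 := rfl
  have hFof : ∀ q, F (.of q) = (of (out q) : ExtSemiring R) • m₀ := fun _ => rfl
  have hFi : F .infty = (infty : ExtSemiring R) • m₀ := rfl
  have hzero : ∀ r, (of r : ExtSemiring R) • m₀ ≠ 0 := fun r h => h0 (by
    rw [← infty_smul_of_smul R r, h, smul_zero])
  have hinfty : ∀ r, (of r : ExtSemiring R) • m₀ ≠ (infty : ExtSemiring R) • m₀ := fun r h => he (by
    rw [← of_smul_infty_smul R 0, ← h, of_zero_smul_of_smul])
  refine IsInjectiveSemimodule.of_equiv (ExtModule.isInjectiveSemimodule (R := R) (N := R ⧸ I))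
    (LinearEquiv.ofBijective F ⟨?_, fun m => ?_⟩)
  · intro x y h
    cases x with
    | zero =>
      cases y with
      | zero => rfl
      | of q => exact absurd h.symm (hzero _)
      | infty => exact absurd h.symm h0
    | of q =>
      cases y with
      | zero => exact absurd h (hzero _)
      | of q' =>
        rw [hFof, hFof, ← hI, hout, hout] at h
        rw [h]
      | infty => exact absurd h (hinfty _)
    | infty =>
      cases y with
      | zero => exact absurd h h0
      | of q => exact absurd h.symm (hinfty _)
      | infty => rfl
  · obtain ⟨s, rfl⟩ := hgen m
    cases s with
    | zero => exact ⟨.zero, (zero_smul (ExtSemiring R) m₀).symm⟩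
    | of r => exact ⟨.of (I.mkQ r), by rw [hFof, ← hI, hout]⟩
    | infty => exact ⟨.infty, hFi⟩

/-- If `Ext(R)` is a left CI-semiring then `R` is semisimple, by Osofsky's theorem: a homomorphism
from a left ideal of `R` to `R ⧸ I` extends because the induced map between the semimodules with
`0` and `∞` adjoined does. -/
theorem isSemisimpleRing_of_isLeftCISemiring (h : IsLeftCISemiring (ExtSemiring R)) :
    IsSemisimpleRing R := by
  refine CyclicBaer.isSemisimpleRing fun I G hG => ?_
  let p : ExtSemiring R →ₗ[ExtSemiring R] ExtModule (R ⧸ I) :=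
    LinearMap.toSpanSingleton _ _ (.of (I.mkQ 1))
  have hp : Function.Surjective p := by
    intro x
    cases x with
    | zero => exact ⟨0, map_zero p⟩
    | of q =>
      obtain ⟨r, rfl⟩ := I.mkQ_surjective q
      refine ⟨of r, ?_⟩
      change ExtModule.of (r • I.mkQ 1) = _
      rw [← map_smul, smul_eq_mul, mul_one]
    | infty => exact ⟨infty, rfl⟩
  let fst : G →ₗ[R] R := (LinearMap.fst R R (R ⧸ I)).comp G.subtype
  let snd : G →ₗ[R] R ⧸ I := (LinearMap.snd R R (R ⧸ I)).comp G.subtype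
  have hinj : Function.Injective fst := by
    rw [← LinearMap.ker_eq_bot, LinearMap.ker_eq_bot']
    rintro ⟨⟨x, y⟩, hxy⟩ h
    obtain rfl : x = 0 := h
    obtain rfl := hG y hxy
    rfl
  obtain ⟨g, hg⟩ := h (ExtModule (R ⧸ I)) ⟨p, hp⟩ (ExtModule G) (ExtModule R)
    (ExtModule.map fst) (ExtModule.map_injective hinj) (ExtModule.map snd)
  have hgG : ∀ x : G, (of x.1.1 : ExtSemiring R) • g (.of 1) = .of x.1.2 := by
    intro x
    rw [← map_smul, ExtModule.of_smul_of, smul_eq_mul, mul_one]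
    exact LinearMap.congr_fun hg (.of x)
  cases hc : g (.of 1) with
  | of c =>
    refine ⟨c, fun x hx => ?_⟩
    have := hgG ⟨x, hx⟩
    rw [hc, ExtModule.of_smul_of] at this
    exact (ExtModule.of.inj this).symm
  | zero =>
    have := hgG 0
    rw [hc, ← ExtModule.zero_def, smul_zero] at this
    cases this
  | infty =>
    have := hgG 0
    rw [hc, ExtModule.of_smul_infty] at this
    cases this

/-- The three-element chain semiring is `Ext(0)`. -/
theorem nonempty_equiv_chainSemiring [Subsingleton R] :
    Nonempty (ExtSemiring R ≃+* ChainSemiring 2) := by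
  let F : ExtSemiring R → ChainSemiring 2
    | zero => (0 : Fin 3)
    | of _ => (1 : Fin 3)
    | infty => (2 : Fin 3)
  let F' : ExtSemiring R →+* ChainSemiring 2 :=
    { toFun := F
      map_zero' := rfl
      map_one' := rfl
      map_add' := fun x y => by cases x <;> cases y <;> rfl
      map_mul' := fun x y => by cases x <;> cases y <;> rfl }
  refine ⟨RingEquiv.ofBijective F' ⟨fun x y h => ?_, fun x => ?_⟩⟩
  · cases x <;> cases y <;> first | rfl | exact congrArg of (Subsingleton.elim _ _) | cases h
  · match x with
    | (0 : Fin 3) => exact ⟨zero, rfl⟩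
    | (1 : Fin 3) => exact ⟨of 0, rfl⟩
    | (2 : Fin 3) => exact ⟨infty, rfl⟩

end ExtSemiring

theorem isLeftCISemiring_of_isBooleanOrChainOrExt {T : Type u} [Semiring T]
    (hT : IsBooleanOrChainOrExt T) : IsLeftCISemiring T := by
  rcases hT with ⟨⟨e⟩⟩ | ⟨⟨e⟩⟩ | ⟨R, _, _, hR, ⟨e⟩⟩
  · exact isLeftCISemiring_of_equiv_boolean e
  · obtain ⟨e'⟩ := ExtSemiring.nonempty_equiv_chainSemiring (R := PUnit.{u + 1})
    exact (isLeftCISemiring_congr (e.trans e'.symm)).2 ExtSemiring.isLeftCISemiring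
  · exact (isLeftCISemiring_congr e).2 ExtSemiring.isLeftCISemiring

/-! ### Zerosumfree semirings: the infinite element -/

section Zerosumfree

variable {S : Type u} [Semiring S]

theorem mul_ne_zero_of_zerosumfree [Nontrivial S] (hz : ∀ x y : S, x + y = 0 → x = 0)
    (ha : ∀ s : S, s ≠ 0 → ∃ t, s = 1 + t) {s t : S} (hs : s ≠ 0) (ht : t ≠ 0) : s * t ≠ 0 := by
  obtain ⟨a, rfl⟩ := ha s hs
  obtain ⟨b, rfl⟩ := ha t ht
  rw [mul_add, mul_one, add_assoc]
  exact fun h => one_ne_zero (hz _ _ h)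

/-- A left CI-semiring that is zerosumfree and anti-bounded has an infinite element, the image of a
new element `∞` under a retraction of `S ∪ {∞}` onto `S`. -/
theorem exists_infinite_element [Nontrivial S] (hS : IsLeftCISemiring S)
    (hz : ∀ x y : S, x + y = 0 → x = 0) (ha : ∀ s : S, s ≠ 0 → ∃ t, s = 1 + t) :
    ∃ w : S, (∀ s, s + w = w) ∧ (∀ s, s ≠ 0 → s * w = w) ∧ ∀ s, s ≠ 0 → w * s = w := by
  classical
  obtain ⟨g, hg, hg'⟩ := hS.exists_retraction (RingHom.id S) Function.surjective_id
    (⟨⟨((↑) : S → WithTop S), rfl⟩, fun _ _ => rfl⟩ : S →+ WithTop S) WithTop.coe_injective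
  let φ : S →+ WithTop S :=
    { toFun := fun s => if s = 0 then 0 else ⊤
      map_zero' := if_pos rfl
      map_add' := fun s t => by
        by_cases hs : s = 0
        · simp [hs]
        · have : s + t ≠ 0 := fun h => hs (hz s t h)
          simp [hs, this] }
  have hadd : ∀ s, s + g φ = g φ := by
    intro s
    conv_lhs => rw [← hg' s, ← map_add]
    congr 1
    ext t
    by_cases ht : t = 0 <;> simp [φ, ht]
  refine ⟨g φ, hadd, fun s hs => ?_, fun s hs => ?_⟩
  · rw [← RingHom.id_apply (α := S) s, ← hg]
    congr 1
    ext t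
    by_cases ht : t = 0
    · simp [φ, ht]
    · simp [φ, ht, mul_ne_zero_of_zerosumfree hz ha ht hs]
  · obtain ⟨t, rfl⟩ := ha s hs
    rw [mul_add, mul_one, add_comm, hadd]

end Zerosumfree

/-! ### An idempotent below the identity -/

/-- The semiring of the natural numbers truncated at `2`: all numbers from `2` on are identified. -/
inductive TruncNat : Type u
  | zero : TruncNat
  | one : TruncNat
  | many : TruncNat

namespace TruncNat

instance : Zero TruncNat := ⟨zero⟩
instance : One TruncNat := ⟨one⟩
instance : Add TruncNat := ⟨fun
  | zero, y => y
  | x, zero => x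
  | _, _ => many⟩
instance : Mul TruncNat := ⟨fun
  | zero, _ => zero
  | _, zero => zero
  | one, y => y
  | many, _ => many⟩

instance : Semiring TruncNat where
  add_assoc x y z := by cases x <;> cases y <;> cases z <;> rfl
  zero_add x := by cases x <;> rfl
  add_zero x := by cases x <;> rfl
  add_comm x y := by cases x <;> cases y <;> rfl
  mul_assoc x y z := by cases x <;> cases y <;> cases z <;> rfl
  one_mul x := by cases x <;> rfl
  mul_one x := by cases x <;> rfl
  zero_mul x := by cases x <;> rfl
  mul_zero x := by cases x <;> rfl
  left_distrib x y z := by cases x <;> cases y <;> cases z <;> rfl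
  right_distrib x y z := by cases x <;> cases y <;> cases z <;> rfl
  nsmul := nsmulRec

end TruncNat

/-- The commutative monoid generated by three elements such that the sum of any two different ones
is the same element `one`, all other sums of two or more generators being identified. -/
inductive TriangleMonoid : Type u
  | zero : TriangleMonoid
  | gen (i : Fin 3) : TriangleMonoid
  | one : TriangleMonoid
  | many : TriangleMonoid

namespace TriangleMonoid

/-- The sum of two different generators is `one`; other sums of nonzero elements are `many`. -/
def add : TriangleMonoid → TriangleMonoid → TriangleMonoid
  | zero, y => y
  | x, zero => x
  | gen i, gen j => if i = j then many else one
  | _, _ => many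

instance : Zero TriangleMonoid := ⟨zero⟩
instance : Add TriangleMonoid := ⟨add⟩

instance : AddCommMonoid TriangleMonoid where
  add_assoc x y z := by
    change add (add x y) z = add x (add y z)
    cases x <;> cases y <;> cases z <;> simp only [add] <;> split_ifs <;> rfl
  zero_add x := by cases x <;> rfl
  add_zero x := by cases x <;> rfl
  add_comm x y := by
    change add x y = add y x
    cases x <;> cases y <;> simp [add, eq_comm]
  nsmul := nsmulRec

theorem gen_add_gen {i j : Fin 3} (h : i ≠ j) : (gen i + gen j : TriangleMonoid) = one := if_neg h

theorem gen_add_self (i : Fin 3) : (gen i + gen i : TriangleMonoid) = many := if_pos rfl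

end TriangleMonoid

/-- The truncated natural numbers are not a CI-semiring. A retraction would produce elements
`x 0`, `x 1`, `x 2` with `x i + x j = 1` for `i ≠ j`, so exactly one of any two of them would be
`0`. -/
theorem not_isLeftCISemiring_truncNat : ¬ IsLeftCISemiring TruncNat.{u} := by
  intro h
  let ψ : TruncNat.{u} →+ TriangleMonoid.{u} :=
    { toFun := fun
        | .zero => .zero
        | .one => .one
        | .many => .many
      map_zero' := rfl
      map_add' := fun x y => by cases x <;> cases y <;> rfl }
  have hψ : Function.Injective ψ := by
    intro x y h
    cases x <;> cases y <;> first | rfl | cases h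
  obtain ⟨g, -, hg⟩ := h.exists_retraction (RingHom.id TruncNat.{u}) Function.surjective_id ψ hψ
  let φ (i : Fin 3) : TruncNat.{u} →+ TriangleMonoid.{u} :=
    { toFun := fun
        | .zero => .zero
        | .one => .gen i
        | .many => .many
      map_zero' := rfl
      map_add' := fun x y => by
        cases x <;> cases y <;> first | rfl | exact (TriangleMonoid.gen_add_self i).symm }
  have hφ : ∀ i j, i ≠ j → g (φ i) + g (φ j) = 1 := by
    intro i j hij
    rw [← hg 1, ← map_add]
    congr 1
    ext x
    cases x
    · rfl
    · exact TriangleMonoid.gen_add_gen hij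
    · rfl
  have h01 := hφ 0 1 (by decide)
  have h02 := hφ 0 2 (by decide)
  have h12 := hφ 1 2 (by decide)
  generalize g (φ 0) = x at *
  generalize g (φ 1) = y at *
  generalize g (φ 2) = z at *
  cases x <;> cases y <;> cases z <;> first | (cases h01; done) | (cases h02; done) |
    cases h12

section Zerosumfree

variable {S : Type u} [Semiring S]

/-- In a zerosumfree anti-bounded left CI-semiring there is `e ≠ 0` with `1 + e = 1`: otherwise `1`
is not of the form `1 + 1 + t`, and the truncated natural numbers are a homomorphic image. -/
theorem exists_ne_zero_one_add_eq_one [Nontrivial S] (hS : IsLeftCISemiring S)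
    (hz : ∀ x y : S, x + y = 0 → x = 0) (ha : ∀ s : S, s ≠ 0 → ∃ t, s = 1 + t) :
    ∃ e : S, e ≠ 0 ∧ 1 + e = 1 := by
  classical
  by_contra! hcon
  have h1 : ∀ t : S, 1 + t ≠ 0 := fun t h => one_ne_zero (hz _ _ h)
  have h2 : ∀ t : S, 1 + 1 + t ≠ 1 := fun t h => hcon (1 + t) (h1 t) (by rw [← add_assoc, h])
  have h11 : (1 : S) + 1 ≠ 1 := fun h => h2 0 (by rw [add_zero, h])
  have hsplit : ∀ s : S, s ≠ 0 → s ≠ 1 → ∃ t, s = 1 + 1 + t := by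
    intro s hs hs1
    obtain ⟨t, rfl⟩ := ha s hs
    obtain ⟨r, rfl⟩ := ha t (fun h => hs1 (by rw [h, add_zero]))
    exact ⟨r, (add_assoc _ _ _).symm⟩
  have hadd : ∀ s t : S, s ≠ 0 → t ≠ 0 → s + t ≠ 1 := by
    intro s t hs ht
    obtain ⟨a, rfl⟩ := ha s hs
    obtain ⟨b, rfl⟩ := ha t ht
    rw [add_add_add_comm]
    exact h2 _
  have hmul : ∀ s t : S, s ≠ 0 → t ≠ 0 → s * t = 1 → s = 1 ∧ t = 1 := by
    intro s t hs ht hst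
    constructor
    · by_contra hs1
      obtain ⟨a, rfl⟩ := hsplit s hs hs1
      obtain ⟨b, rfl⟩ := ha t ht
      rw [mul_add, mul_one, add_assoc] at hst
      exact h2 _ hst
    · by_contra ht1
      obtain ⟨a, rfl⟩ := hsplit t ht ht1
      obtain ⟨b, rfl⟩ := ha s hs
      rw [add_mul, one_mul, add_assoc] at hst
      exact h2 _ hst
  let π : S →+* TruncNat.{u} :=
    { toFun := fun s => if s = 0 then .zero else if s = 1 then .one else .many
      map_zero' := if_pos rfl
      map_one' := (if_neg one_ne_zero).trans (if_pos rfl)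
      map_add' := fun s t => by
        by_cases hs : s = 0
        · simp only [hs, zero_add, if_true]
          exact (zero_add _).symm
        by_cases ht : t = 0
        · simp only [ht, add_zero, if_true]
          exact (add_zero _).symm
        have hst : s + t ≠ 0 := fun h => hs (hz s t h)
        simp only [hs, ht, hst, hadd s t hs ht, if_false]
        by_cases hs1 : s = 1 <;> by_cases ht1 : t = 1 <;>
            simp only [hs1, ht1, if_true, if_false] <;> rfl
      map_mul' := fun s t => by
        by_cases hs : s = 0
        · simp only [hs, zero_mul, if_true]
          exact (zero_mul _).symm
        by_cases ht : t = 0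
        · simp only [ht, mul_zero, if_true]
          exact (mul_zero _).symm
        have hst := mul_ne_zero_of_zerosumfree hz ha hs ht
        by_cases hs1 : s = 1
        · subst hs1
          simp only [one_mul, one_ne_zero, if_true, if_false]
          exact (one_mul _).symm
        have hst1 : s * t ≠ 1 := fun h => hs1 (hmul s t hs ht h).1
        simp only [hs, ht, hst, hs1, hst1, if_false]
        by_cases ht1 : t = 1 <;> simp only [ht1, if_true, if_false] <;> rfl }
  refine not_isLeftCISemiring_truncNat (hS.of_surjective π fun x => ?_)
  cases x with
  | zero => exact ⟨0, map_zero π⟩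
  | one => exact ⟨1, map_one π⟩
  | many => exact ⟨1 + 1, by rw [map_add, map_one]; rfl⟩

/-! ### Zerosumfree CI-semirings -/

/-- Let `e ≠ 0` satisfy `1 + e = 1`. Then `e` is neutral for the addition of nonzero elements, and
it is a zero for the multiplication with elements `s` such that `s + t = e` for some `t`. -/
theorem one_add_eq_one_properties [Nontrivial S] (hz : ∀ x y : S, x + y = 0 → x = 0)
    (ha : ∀ s : S, s ≠ 0 → ∃ t, s = 1 + t) {e : S} (he0 : e ≠ 0) (he : 1 + e = 1) :
    (∀ s, s ≠ 0 → s + e = s) ∧ (∃ f, 1 + f = e) ∧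
      ∀ s, s ≠ 0 → (∃ t, s + t = e) → e * s = e ∧ s * e = e := by
  have hadd : ∀ s, s ≠ 0 → s + e = s := by
    intro s hs
    obtain ⟨t, rfl⟩ := ha s hs
    rw [add_right_comm, he]
  have hee : e * e = e := by
    have h1 : e + e * e = e := by
      conv_rhs => rw [← mul_one e, ← he, mul_add, mul_one]
    rw [← hadd (e * e) (mul_ne_zero_of_zerosumfree hz ha he0 he0), add_comm, h1]
  refine ⟨hadd, (ha e he0).imp fun _ h => h.symm, ?_⟩
  rintro s hs ⟨t, ht⟩
  constructor
  · have h1 : e * s + e * t = e := by rw [← mul_add, ht, hee]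
    have h2 : e * s + e * s = e * s := by rw [← add_mul, hadd e he0]
    calc e * s = e * s + e := (hadd _ (mul_ne_zero_of_zerosumfree hz ha he0 hs)).symm
      _ = e * s + (e * s + e * t) := by rw [h1]
      _ = e := by rw [← add_assoc, h2, h1]
  · have h1 : s * e + t * e = e := by rw [← add_mul, ht, hee]
    have h2 : s * e + s * e = s * e := by rw [← mul_add, hadd e he0]
    calc s * e = s * e + e := (hadd _ (mul_ne_zero_of_zerosumfree hz ha hs he0)).symm
      _ = s * e + (s * e + t * e) := by rw [h1]
      _ = e := by rw [← add_assoc, h2, h1]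

/-- In a zerosumfree anti-bounded left CI-semiring with infinite element `w`, a nonzero element
`q` without negative with respect to `e` is equal to `w`. The semiring maps to `Ext(0)`, whose
elements `0`, `0_R`, `∞` are the images of `0`, of the elements that have a negative, and of the
other ones. Let `D` be the set of all `s` with `e s + e q = e q`, that is, of the elements `s`
below `e q`. If `q ≠ w` then `w ∉ D`. The additive map `φ` with value `0_R` on the nonzero
elements of `D` and `∞` outside of `D` goes, under a retraction onto `Ext(0)`, to an element `x`.
Since `q φ` has value `0_R` at elements with a negative, `∞ x + 1 = 1`; since `w φ` has value `∞`
at all nonzero elements, `∞ x = ∞`. -/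
theorem eq_infinite_element [Nontrivial S] (hS : IsLeftCISemiring S)
    (hz : ∀ x y : S, x + y = 0 → x = 0) (ha : ∀ s : S, s ≠ 0 → ∃ t, s = 1 + t) {w e : S}
    (hw : ∀ s, s + w = w) (hsw : ∀ s, s ≠ 0 → s * w = w)
    (he0 : e ≠ 0) (he : 1 + e = 1) (hwe : w ≠ e)
    {q : S} (hq0 : q ≠ 0) (hq : ¬ ∃ t, q + t = e) : q = w := by
  classical
  by_contra hqw
  obtain ⟨hadd, ⟨f, hf⟩, hmul⟩ := one_add_eq_one_properties hz ha he0 he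
  have hz' : ∀ {s t : S}, s ≠ 0 → s + t ≠ 0 := fun hs h => hs (hz _ _ h)
  have hm' : ∀ {s t : S}, s ≠ 0 → t ≠ 0 → s * t ≠ 0 := mul_ne_zero_of_zerosumfree hz ha
  let U : S → Prop := fun s => ∃ t, s + t = e
  have hUadd : ∀ s t, U (s + t) ↔ U s ∧ U t := by
    refine fun s t => ⟨?_, ?_⟩
    · rintro ⟨r, hr⟩
      exact ⟨⟨t + r, by rw [← add_assoc, hr]⟩, ⟨s + r, by rw [← hr, add_left_comm, add_assoc]⟩⟩
    · rintro ⟨⟨s', hs⟩, ⟨t', ht⟩⟩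
      exact ⟨s' + t', by rw [add_add_add_comm, hs, ht, hadd e he0]⟩
  have hUmul : ∀ s t, s ≠ 0 → t ≠ 0 → (U (s * t) ↔ U s ∧ U t) := by
    refine fun s t hs ht => ⟨fun h => ⟨?_, ?_⟩, ?_⟩
    · obtain ⟨b, rfl⟩ := ha t ht
      rw [mul_add, mul_one, hUadd] at h
      exact h.1
    · obtain ⟨b, rfl⟩ := ha s hs
      rw [add_mul, one_mul, hUadd] at h
      exact h.1
    · rintro ⟨⟨s', hs'⟩, hUt⟩
      exact ⟨s' * t, by rw [← add_mul, hs', (hmul t ht hUt).1]⟩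
  have hUw : ¬ U w := by
    rintro ⟨t, ht⟩
    rw [add_comm, hw] at ht
    exact hwe ht
  let π₀ : S → ExtSemiring PUnit.{u + 1} := fun s =>
    if s = 0 then .zero else if U s then .of 0 else .infty
  have hπU : ∀ s, s ≠ 0 → U s → π₀ s = .of 0 := fun s h h' => by
    simp only [π₀, h, h', if_true, if_false]
  have hπQ : ∀ s, s ≠ 0 → ¬ U s → π₀ s = .infty := fun s h h' => by
    simp only [π₀, h, h', if_false]
  have hπ0 : π₀ 0 = 0 := if_pos rfl
  let π : S →+* ExtSemiring PUnit.{u + 1} :=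
    { toFun := π₀
      map_zero' := hπ0
      map_one' := hπU 1 one_ne_zero ⟨f, hf⟩
      map_add' := fun s t => by
        by_cases hs : s = 0
        · rw [hs, hπ0, zero_add, zero_add]
        by_cases ht : t = 0
        · rw [ht, hπ0, add_zero, add_zero]
        by_cases hUs : U s <;> by_cases hUt : U t
        · rw [hπU s hs hUs, hπU t ht hUt, hπU _ (hz' hs) ((hUadd s t).2 ⟨hUs, hUt⟩)]; rfl
        · rw [hπU s hs hUs, hπQ t ht hUt, hπQ _ (hz' hs) (fun h => hUt ((hUadd s t).1 h).2)]; rfl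
        · rw [hπQ s hs hUs, hπU t ht hUt, hπQ _ (hz' hs) (fun h => hUs ((hUadd s t).1 h).1)]; rfl
        · rw [hπQ s hs hUs, hπQ t ht hUt, hπQ _ (hz' hs) (fun h => hUs ((hUadd s t).1 h).1)]; rfl
      map_mul' := fun s t => by
        by_cases hs : s = 0
        · rw [hs, hπ0, zero_mul, zero_mul, hπ0]
        by_cases ht : t = 0
        · rw [ht, hπ0, mul_zero, mul_zero, hπ0]
        have h := hUmul s t hs ht
        by_cases hUs : U s <;> by_cases hUt : U t
        · rw [hπU s hs hUs, hπU t ht hUt, hπU _ (hm' hs ht) (h.2 ⟨hUs, hUt⟩)]; rfl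
        · rw [hπU s hs hUs, hπQ t ht hUt, hπQ _ (hm' hs ht) (fun h' => hUt (h.1 h').2)]; rfl
        · rw [hπQ s hs hUs, hπU t ht hUt, hπQ _ (hm' hs ht) (fun h' => hUs (h.1 h').1)]; rfl
        · rw [hπQ s hs hUs, hπQ t ht hUt, hπQ _ (hm' hs ht) (fun h' => hUs (h.1 h').1)]; rfl }
  have hπs : Function.Surjective π := by
    intro x
    cases x with
    | zero => exact ⟨0, map_zero π⟩
    | of r => exact ⟨1, map_one π⟩
    | infty => exact ⟨q, hπQ q hq0 hq⟩
  obtain ⟨g, hg, hg'⟩ := hS.exists_retraction π hπs (AddMonoidHom.id _) Function.injective_id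
  set p := e * q with hp
  let D : S → Prop := fun s => e * s + p = p
  have hDadd1 : ∀ s t, D (s + t) → D s := by
    intro s t h
    change e * s + p = p
    have h : e * (s + t) + p = p := h
    conv_lhs => rw [← h, mul_add, ← add_assoc, ← add_assoc, ← add_mul, hadd e he0, ← mul_add, h]
  have hDadd : ∀ s t, D (s + t) ↔ D s ∧ D t := by
    refine fun s t => ⟨fun h => ⟨hDadd1 s t h, hDadd1 t s (by rwa [add_comm])⟩, ?_⟩
    rintro ⟨h, h'⟩
    change e * (s + t) + p = p
    rw [mul_add, add_assoc, show _ + p = p from h', show _ + p = p from h]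
  have hDUq : ∀ s, s ≠ 0 → U s → D (s * q) := by
    intro s hs hUs
    change e * (s * q) + p = p
    rw [← mul_assoc, (hmul s hs hUs).1, hp, ← add_mul, hadd e he0]
  have hDw : ¬ D w := by
    intro h
    have h : e * w + p = p := h
    rw [hsw e he0, add_comm, hw] at h
    refine hqw ?_
    have h1 : q + p = q := by
      conv_rhs => rw [← one_mul q, ← he, add_mul, one_mul]
    rw [← h1, ← h, hw]
  let φ₀ : S → ExtSemiring PUnit.{u + 1} := fun s =>
    if s = 0 then .zero else if D s then .of 0 else .infty
  have hφD : ∀ s, s ≠ 0 → D s → φ₀ s = .of 0 := fun s h h' => by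
    simp only [φ₀, h, h', if_true, if_false]
  have hφQ : ∀ s, s ≠ 0 → ¬ D s → φ₀ s = .infty := fun s h h' => by
    simp only [φ₀, h, h', if_false]
  have hφ0 : φ₀ 0 = 0 := if_pos rfl
  let φ : S →+ ExtSemiring PUnit.{u + 1} :=
    { toFun := φ₀
      map_zero' := hφ0
      map_add' := fun s t => by
        by_cases hs : s = 0
        · rw [hs, hφ0, zero_add, zero_add]
        by_cases ht : t = 0
        · rw [ht, hφ0, add_zero, add_zero]
        by_cases hUs : D s <;> by_cases hUt : D t
        · rw [hφD s hs hUs, hφD t ht hUt, hφD _ (hz' hs) ((hDadd s t).2 ⟨hUs, hUt⟩)]; rfl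
        · rw [hφD s hs hUs, hφQ t ht hUt, hφQ _ (hz' hs) (fun h => hUt ((hDadd s t).1 h).2)]; rfl
        · rw [hφQ s hs hUs, hφD t ht hUt, hφQ _ (hz' hs) (fun h => hUs ((hDadd s t).1 h).1)]; rfl
        · rw [hφQ s hs hUs, hφQ t ht hUt, hφQ _ (hz' hs) (fun h => hUs ((hDadd s t).1 h).1)]; rfl }
  have hw0 : w ≠ 0 := fun h => one_ne_zero (α := S) (by rw [← add_zero (1 : S), ← h, hw])
  have hinf : ∀ x : ExtSemiring PUnit.{u + 1}, x + .infty = .infty := fun x => by cases x <;> rfl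
  -- A map with value `0_R` at the elements with a negative retracts to an element `≤ 1`.
  have hle : ∀ χ : S →+ ExtSemiring PUnit.{u + 1},
      (∀ s, s ≠ 0 → U s → χ s = .of 0) → g χ + 1 = 1 := by
    intro χ hχ
    conv_lhs => rw [← hg' 1, ← map_add]
    conv_rhs => rw [← hg' 1]
    congr 1
    ext s
    change χ s + π s * 1 = π s * 1
    rw [mul_one]
    by_cases hs : s = 0
    · rw [hs, map_zero, map_zero, add_zero]
    by_cases hUs : U s
    · rw [hχ s hs hUs, show π s = _ from hπU s hs hUs]; rfl
    · rw [show π s = _ from hπQ s hs hUs, hinf]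
  have h2 : π q * g φ + 1 = 1 := by
    rw [← hg]
    exact hle _ fun s hs hUs => hφD _ (hm' hs hq0) (hDUq s hs hUs)
  have h3 : π w * g φ = .infty := by
    rw [← hg, ← hg' .infty]
    congr 1
    ext s
    change φ₀ (s * w) = π s * .infty
    by_cases hs : s = 0
    · rw [hs, zero_mul, map_zero, zero_mul, hφ0]
    · rw [hsw s hs, hφQ w hw0 hDw]
      by_cases hUs : U s
      · rw [show π s = _ from hπU s hs hUs]; rfl
      · rw [show π s = _ from hπQ s hs hUs]; rfl
  rw [show π q = .infty from hπQ q hq0 hq] at h2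
  rw [show π w = .infty from hπQ w hw0 hUw] at h3
  rw [h3] at h2
  cases h2

theorem nonempty_equiv_boolean_of_eq_zero_or_one [Nontrivial S] (h : ∀ s : S, s = 0 ∨ s = 1)
    (h11 : (1 : S) + 1 = 1) : Nonempty (S ≃+* BooleanSemiring) := by
  let F : BooleanSemiring → S
    | false => 0
    | true => 1
  let F' : BooleanSemiring →+* S :=
    { toFun := F
      map_zero' := rfl
      map_one' := rfl
      map_add' := fun x y => by
        match x, y with
        | false, y => exact (zero_add _).symm
        | true, false => exact (add_zero _).symm
        | true, true => exact h11.symm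
      map_mul' := fun x y => by
        match x, y with
        | false, y => exact (zero_mul _).symm
        | true, y => exact (one_mul _).symm }
  refine ⟨(RingEquiv.ofBijective F' ⟨fun x y hxy => ?_, fun s => ?_⟩).symm⟩
  · match x, y with
    | false, false => rfl
    | true, true => rfl
    | false, true => exact absurd hxy zero_ne_one
    | true, false => exact absurd hxy one_ne_zero
  · rcases h s with rfl | rfl
    · exact ⟨0, map_zero F'⟩
    · exact ⟨1, map_one F'⟩

/-- If every element of `S` is `0`, infinite, or has a negative with respect to `e`, where
`1 + e = 1`, then the elements with a negative form a ring `R` with zero `e`, and `S` is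
`Ext(R)`. -/
theorem exists_equiv_extSemiring [Nontrivial S] (hz : ∀ x y : S, x + y = 0 → x = 0)
    (ha : ∀ s : S, s ≠ 0 → ∃ t, s = 1 + t) {w e : S} (hw : ∀ s, s + w = w)
    (hsw : ∀ s, s ≠ 0 → s * w = w) (hws : ∀ s, s ≠ 0 → w * s = w) (he0 : e ≠ 0)
    (he : 1 + e = 1) (hwe : w ≠ e) (hU : ∀ q : S, q ≠ 0 → (¬ ∃ t, q + t = e) → q = w) :
    ∃ (R : Type u) (_ : Ring R), Nonempty (ExtSemiring R ≃+* S) := by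
  obtain ⟨hadd, ⟨f, hf⟩, hmul⟩ := one_add_eq_one_properties hz ha he0 he
  let U := {s : S // s ≠ 0 ∧ ∃ t, s + t = e}
  have hneg : ∀ s : U, ∃ t : U, t.1 + s.1 = e := by
    rintro ⟨s, hs, t, ht⟩
    have h : s + (t + e) = e := by rw [← add_assoc, ht, hadd e he0]
    exact ⟨⟨t + e, fun h => he0 (hz e t (by rwa [add_comm])), s, by rwa [add_comm]⟩,
      by rwa [add_comm]⟩
  choose neg hneg using hneg
  let _ : Add U := ⟨fun x y => ⟨x.1 + y.1, fun h => x.2.1 (hz _ _ h), by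
    obtain ⟨s, hs⟩ := x.2.2
    obtain ⟨t, ht⟩ := y.2.2
    exact ⟨s + t, by rw [add_add_add_comm, hs, ht, hadd e he0]⟩⟩⟩
  let _ : Zero U := ⟨⟨e, he0, e, hadd e he0⟩⟩
  let _ : Neg U := ⟨neg⟩
  let _ : Ring U :=
    { mul := fun x y => ⟨x.1 * y.1, mul_ne_zero_of_zerosumfree hz ha x.2.1 y.2.1, by
        obtain ⟨s, hs⟩ := x.2.2
        exact ⟨s * y.1, by rw [← add_mul, hs, (hmul _ y.2.1 y.2.2).1]⟩⟩
      one := ⟨1, one_ne_zero, f, hf⟩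
      add_assoc := fun x y z => Subtype.ext (add_assoc x.1 y.1 z.1)
      add_comm := fun x y => Subtype.ext (add_comm x.1 y.1)
      zero_add := fun x => Subtype.ext ((add_comm e x.1).trans (hadd x.1 x.2.1))
      add_zero := fun x => Subtype.ext (hadd x.1 x.2.1)
      neg_add_cancel := fun x => Subtype.ext (hneg x)
      mul_assoc := fun x y z => Subtype.ext (mul_assoc x.1 y.1 z.1)
      one_mul := fun x => Subtype.ext (one_mul x.1)
      mul_one := fun x => Subtype.ext (mul_one x.1)
      zero_mul := fun x => Subtype.ext (hmul x.1 x.2.1 x.2.2).1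
      mul_zero := fun x => Subtype.ext (hmul x.1 x.2.1 x.2.2).2
      left_distrib := fun x y z => Subtype.ext (mul_add x.1 y.1 z.1)
      right_distrib := fun x y z => Subtype.ext (add_mul x.1 y.1 z.1)
      nsmul := nsmulRec
      zsmul := zsmulRec }
  have hw0 : w ≠ 0 := fun h => one_ne_zero (α := S) (by rw [← add_zero (1 : S), ← h, hw])
  have hws' : ∀ s, w + s = w := fun s => by rw [add_comm, hw]
  have hUw : ∀ x : U, x.1 ≠ w := by
    rintro ⟨s, hs, t, ht⟩ hsw
    obtain rfl : s = w := hsw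
    exact hwe ((hws' t).symm.trans ht)
  let F : ExtSemiring U → S
    | .zero => 0
    | .of x => x.1
    | .infty => w
  let F' : ExtSemiring U →+* S :=
    { toFun := F
      map_zero' := rfl
      map_one' := rfl
      map_add' := fun x y => by
        cases x with
        | zero => exact (zero_add _).symm
        | of x =>
          cases y with
          | zero => exact (add_zero _).symm
          | of y => rfl
          | infty => exact (hw _).symm
        | infty => cases y <;> exact (hws' _).symm
      map_mul' := fun x y => by
        cases x with
        | zero => exact (zero_mul _).symm
        | of x =>
          cases y with
          | zero => exact (mul_zero _).symm
          | of y => rfl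
          | infty => exact (hsw _ x.2.1).symm
        | infty =>
          cases y with
          | zero => exact (mul_zero _).symm
          | of y => exact (hws _ y.2.1).symm
          | infty => exact (hsw _ hw0).symm }
  refine ⟨U, inferInstance, ⟨RingEquiv.ofBijective F' ⟨fun x y h => ?_, fun s => ?_⟩⟩⟩
  · cases x with
    | zero =>
      cases y with
      | zero => rfl
      | of y => exact absurd h.symm y.2.1
      | infty => exact absurd h.symm hw0
    | of x =>
      cases y with
      | zero => exact absurd h x.2.1
      | of y => exact congrArg _ (Subtype.ext h)
      | infty => exact absurd h (hUw x)
    | infty =>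
      cases y with
      | zero => exact absurd h hw0
      | of y => exact absurd h.symm (hUw y)
      | infty => rfl
  · by_cases hs : s = 0
    · exact ⟨.zero, hs.symm⟩
    by_cases hUs : ∃ t, s + t = e
    · exact ⟨.of ⟨s, hs, hUs⟩, rfl⟩
    · exact ⟨.infty, (hU s hs hUs).symm⟩

/-- The classification of the nontrivial zerosumfree anti-bounded left CI-semirings. -/
theorem isBooleanOrChainOrExt_of_zerosumfree [Nontrivial S] (hS : IsLeftCISemiring S)
    (hz : ∀ x y : S, x + y = 0 → x = 0) (ha : ∀ s : S, s ≠ 0 → ∃ t, s = 1 + t) :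
    IsBooleanOrChainOrExt S := by
  obtain ⟨w, hw, hsw, hws⟩ := exists_infinite_element hS hz ha
  obtain ⟨e, he0, he⟩ := exists_ne_zero_one_add_eq_one hS hz ha
  by_cases hwe : w = e
  · subst hwe
    have h1 : w = 1 := by rw [← he, hw]
    refine .inl (nonempty_equiv_boolean_of_eq_zero_or_one (fun s => ?_) ?_)
    · by_cases hs : s = 0
      · exact .inl hs
      · obtain ⟨t, rfl⟩ := ha s hs
        exact .inr (by rw [← h1, add_comm, hw])
    · rw [h1] at he
      exact he
  obtain ⟨R, _, ⟨E⟩⟩ := exists_equiv_extSemiring hz ha hw hsw hws he0 he hwe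
    fun q hq0 hq => eq_infinite_element hS hz ha hw hsw he0 he hwe hq0 hq
  rcases subsingleton_or_nontrivial R with hR | hR
  · obtain ⟨E'⟩ := ExtSemiring.nonempty_equiv_chainSemiring (R := R)
    exact .inr (.inl ⟨E.symm.trans E'⟩)
  · exact .inr (.inr ⟨R, inferInstance, hR, ExtSemiring.isSemisimpleRing_of_isLeftCISemiring
      ((isLeftCISemiring_congr E).2 hS), ⟨E.symm⟩⟩)

end Zerosumfree

/-! ### Splitting off the additively invertible elements -/

section Splitting

variable {S : Type u} [Semiring S]

/-- A semiring whose elements have additive inverses is a ring. -/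
@[reducible] noncomputable def ringOfExistsNeg (S : Type u) [h : Semiring S]
    (hneg : ∀ x : S, ∃ y, x + y = 0) : Ring S :=
  let _ : Neg S := ⟨fun x => (hneg x).choose⟩
  { h with
    zsmul := zsmulRec
    neg_add_cancel := fun x => (add_comm _ _).trans (hneg x).choose_spec }

theorem add_right_cancel_of_exists_neg {a b u : S} (hu : ∃ v, u + v = 0) (h : a + u = b + u) :
    a = b := by
  obtain ⟨v, hv⟩ := hu
  rw [← add_zero a, ← hv, ← add_assoc, h, add_assoc, hv, add_zero]

theorem exists_neg_mul_left (s : S) {v : S} (hv : ∃ v', v + v' = 0) : ∃ t, s * v + t = 0 := by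
  obtain ⟨v', h⟩ := hv
  exact ⟨s * v', by rw [← mul_add, h, mul_zero]⟩

theorem exists_neg_mul_right (s : S) {v : S} (hv : ∃ v', v + v' = 0) : ∃ t, v * s + t = 0 := by
  obtain ⟨v', h⟩ := hv
  exact ⟨v' * s, by rw [← add_mul, h, zero_mul]⟩

theorem exists_neg_add {u v : S} (hu : ∃ u', u + u' = 0) (hv : ∃ v', v + v' = 0) :
    ∃ t, u + v + t = 0 := by
  obtain ⟨u', h⟩ := hu
  obtain ⟨v', h'⟩ := hv
  exact ⟨u' + v', by rw [add_add_add_comm, h, h', add_zero]⟩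

variable (S) in
/-- The congruence that identifies two elements if they differ by an additively invertible
element. -/
def invertibleCon : RingCon S where
  r x y := ∃ v, (∃ v', v + v' = 0) ∧ x + v = y
  iseqv :=
    { refl := fun x => ⟨0, ⟨0, add_zero 0⟩, add_zero x⟩
      symm := by
        rintro x _ ⟨v, ⟨v', h⟩, rfl⟩
        exact ⟨v', ⟨v, by rw [add_comm, h]⟩, by rw [add_assoc, h, add_zero]⟩
      trans := by
        rintro x _ _ ⟨v, hv, rfl⟩ ⟨u, hu, rfl⟩
        exact ⟨v + u, exists_neg_add hv hu, (add_assoc _ _ _).symm⟩ }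
  add' := by
    rintro x _ y _ ⟨v, hv, rfl⟩ ⟨u, hu, rfl⟩
    exact ⟨v + u, exists_neg_add hv hu, add_add_add_comm _ _ _ _⟩
  mul' := by
    rintro x _ y _ ⟨v, hv, rfl⟩ ⟨u, hu, rfl⟩
    refine ⟨x * u + v * (y + u),
      exists_neg_add (exists_neg_mul_left x hu) (exists_neg_mul_right _ hv), ?_⟩
    rw [add_mul, mul_add x, add_assoc]

theorem mk_invertibleCon_eq_zero_iff {a : S} :
    (invertibleCon S).mk' a = 0 ↔ ∃ b, a + b = 0 := by
  rw [← map_zero (invertibleCon S).mk']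
  refine (RingCon.eq _).trans ⟨?_, ?_⟩
  · rintro ⟨v, -, h⟩
    exact ⟨v, h⟩
  · rintro ⟨b, h⟩
    exact ⟨b, ⟨a, by rw [add_comm, h]⟩, h⟩

theorem invertibleCon_zerosumfree (x y : (invertibleCon S).Quotient) (h : x + y = 0) : x = 0 := by
  obtain ⟨a, rfl⟩ := (invertibleCon S).mk'_surjective x
  obtain ⟨b, rfl⟩ := (invertibleCon S).mk'_surjective y
  rw [← map_add, mk_invertibleCon_eq_zero_iff] at h
  obtain ⟨c, hc⟩ := h
  exact mk_invertibleCon_eq_zero_iff.2 ⟨b + c, by rw [← add_assoc, hc]⟩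

theorem invertibleCon_exists_eq_one_add (hS : IsAntiBounded S) (x : (invertibleCon S).Quotient)
    (hx : x ≠ 0) : ∃ t, x = 1 + t := by
  obtain ⟨a, rfl⟩ := (invertibleCon S).mk'_surjective x
  rcases hS a with h | ⟨t, rfl⟩
  · exact absurd (mk_invertibleCon_eq_zero_iff.2 h) hx
  · exact ⟨(invertibleCon S).mk' t, by rw [map_add, map_one]⟩

/-- The equation `1 + W = W + ε` with `ε` additively invertible makes `ε` an identity element of the
ideal `V` of additively invertible elements: multiply by `v ∈ V` and cancel `W v` or `v W`. The
element `W` represents the infinite element of `S / V`. -/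
theorem exists_one_add_eq_add (hS : IsLeftCISemiring S) (ha : IsAntiBounded S) :
    ∃ W ε : S, (∃ ε', ε + ε' = 0) ∧ 1 + W = W + ε := by
  by_cases h1 : (invertibleCon S).mk' 1 = 0
  · exact ⟨0, 1, mk_invertibleCon_eq_zero_iff.1 h1, add_comm 1 0⟩
  have : Nontrivial (invertibleCon S).Quotient := ⟨⟨_, _, h1⟩⟩
  obtain ⟨w, hw, -⟩ := exists_infinite_element
    (hS.of_surjective (invertibleCon S).mk' (invertibleCon S).mk'_surjective)
    invertibleCon_zerosumfree (invertibleCon_exists_eq_one_add ha)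
  obtain ⟨W, rfl⟩ := (invertibleCon S).mk'_surjective w
  have h := hw 1
  rw [← map_one (invertibleCon S).mk', ← map_add] at h
  obtain ⟨v, ⟨ε, hε⟩, h⟩ := (RingCon.eq _).1 h
  refine ⟨W, ε, ⟨v, by rw [add_comm, hε]⟩, ?_⟩
  conv_rhs => rw [← h, add_assoc, hε, add_zero]

/-- An anti-bounded left CI-semiring `S` is the product of a semisimple ring, isomorphic to the
ideal `V` of additively invertible elements, and of `S / V`. -/
theorem exists_equiv_prod (hS : IsLeftCISemiring S) (ha : IsAntiBounded S) :
    ∃ (R : Type u) (_ : Ring R) (T : Type u) (_ : Semiring T), IsSemisimpleRing R ∧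
      (Subsingleton T ∨ IsBooleanOrChainOrExt T) ∧ Nonempty (S ≃+* R × T) := by
  obtain ⟨W, ε, hε, hW⟩ := exists_one_add_eq_add hS ha
  have hl : ∀ v : S, (∃ v', v + v' = 0) → ε * v = v := by
    intro v hv
    have h := congrArg (· * v) hW
    simp only [add_mul, one_mul] at h
    rw [add_comm (W * v)] at h
    exact (add_right_cancel_of_exists_neg (exists_neg_mul_left W hv) h).symm
  have hr : ∀ v : S, (∃ v', v + v' = 0) → v * ε = v := by
    intro v hv
    have h := congrArg (v * ·) hW
    simp only [mul_add, mul_one] at h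
    rw [add_comm (v * W)] at h
    exact (add_right_cancel_of_exists_neg (exists_neg_mul_right W hv) h).symm
  have hcomm : ∀ s, ε * s = s * ε := fun s => by
    rw [← hr _ (exists_neg_mul_right s hε), mul_assoc, hl _ (exists_neg_mul_left s hε)]
  let d : RingCon S :=
    { r := fun x y => ε * x = ε * y
      iseqv := ⟨fun _ => rfl, fun h => h.symm, fun h h' => h.trans h'⟩
      add' := fun {x x' y y'} h h' => by
        rw [mul_add, mul_add, h, h']
      mul' := fun {x x' y y'} h h' => by
        rw [← mul_assoc, h, hcomm, mul_assoc, h', ← mul_assoc, ← hcomm, mul_assoc] }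
  have hd : ∀ x y, d.mk' x = d.mk' y ↔ ε * x = ε * y := fun x y => d.eq
  have hneg : ∀ x : d.Quotient, ∃ y, x + y = 0 := by
    intro x
    obtain ⟨a, rfl⟩ := d.mk'_surjective x
    obtain ⟨b, hb⟩ := exists_neg_mul_right a hε
    refine ⟨d.mk' b, ?_⟩
    rw [← map_add, ← map_zero d.mk', hd, mul_zero, mul_add,
      hl b ⟨ε * a, by rw [add_comm, hb]⟩, hb]
  let _ : Ring d.Quotient := ringOfExistsNeg d.Quotient hneg
  have hCI : IsLeftCISemiring d.Quotient := hS.of_surjective d.mk' d.mk'_surjective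
  refine ⟨d.Quotient, inferInstance, (invertibleCon S).Quotient, inferInstance,
    hCI.cyclicBaer.isSemisimpleRing, ?_, ?_⟩
  · rcases subsingleton_or_nontrivial (invertibleCon S).Quotient with h | h
    · exact .inl h
    · exact .inr (isBooleanOrChainOrExt_of_zerosumfree
        (hS.of_surjective (invertibleCon S).mk' (invertibleCon S).mk'_surjective)
        invertibleCon_zerosumfree (invertibleCon_exists_eq_one_add ha))
  · refine ⟨RingEquiv.ofBijective (d.mk'.prod (invertibleCon S).mk') ⟨fun a b h => ?_, ?_⟩⟩
    · obtain ⟨h1, h2⟩ := Prod.ext_iff.1 h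
      have h1 := (hd a b).1 h1
      obtain ⟨v, hv, rfl⟩ := (RingCon.eq _).1 h2
      rw [mul_add, hl v hv, ← add_zero (ε * a), add_assoc, zero_add, add_comm _ 0,
        add_comm _ v] at h1
      rw [← add_right_cancel_of_exists_neg (exists_neg_mul_right a hε) h1, add_zero]
    · rintro ⟨x, y⟩
      obtain ⟨a, rfl⟩ := d.mk'_surjective x
      obtain ⟨b, rfl⟩ := (invertibleCon S).mk'_surjective y
      obtain ⟨n, hn⟩ := exists_neg_mul_right b hε
      obtain ⟨m, hm⟩ := exists_neg_mul_right a hε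
      refine ⟨ε * a + (b + n), Prod.ext ((hd _ _).2 ?_) ((RingCon.eq _).2 ?_)⟩
      · rw [mul_add, mul_add, hl n ⟨ε * b, by rw [add_comm, hn]⟩, hn, add_zero,
          hl _ (exists_neg_mul_right a hε)]
      · refine ⟨m + ε * b, exists_neg_add ⟨ε * a, by rw [add_comm, hm]⟩
          (exists_neg_mul_right b hε), ?_⟩
        rw [add_add_add_comm, hm, zero_add, add_assoc, add_comm n, hn, add_zero]

end Splitting

/-! ### Left and right -/

/-- A semiring with commutative multiplication is isomorphic to its opposite. -/
def opEquivOfComm {T : Type u} [Semiring T] (h : ∀ x y : T, x * y = y * x) : T ≃+* Tᵐᵒᵖ :=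
  { MulOpposite.opAddEquiv with
    map_mul' := fun x y => congrArg MulOpposite.op (h x y) }

/-- `Ext(R)ᵐᵒᵖ = Ext(Rᵐᵒᵖ)`. -/
def ExtSemiring.opEquiv (R : Type u) [Ring R] : (ExtSemiring R)ᵐᵒᵖ ≃+* ExtSemiring Rᵐᵒᵖ where
  toFun x := match x.unop with
    | .zero => .zero
    | .of r => .of (.op r)
    | .infty => .infty
  invFun
    | .zero => .op .zero
    | .of r => .op (.of r.unop)
    | .infty => .op .infty
  left_inv x := by
    obtain ⟨x⟩ := x
    cases x <;> rfl
  right_inv x := by cases x <;> rfl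
  map_add' x y := by
    obtain ⟨x⟩ := x
    obtain ⟨y⟩ := y
    cases x <;> cases y <;> rfl
  map_mul' x y := by
    obtain ⟨x⟩ := x
    obtain ⟨y⟩ := y
    cases x <;> cases y <;> rfl

theorem isLeftCISemiring_op_of_isBooleanOrChainOrExt {T : Type u} [Semiring T]
    (hT : IsBooleanOrChainOrExt T) : IsLeftCISemiring Tᵐᵒᵖ := by
  rcases hT with ⟨⟨e⟩⟩ | ⟨⟨e⟩⟩ | ⟨R, _, _, hR, ⟨e⟩⟩
  · have h : ∀ x y : BooleanSemiring, x * y = y * x := by decide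
    refine (isLeftCISemiring_congr (opEquivOfComm fun x y => e.injective ?_)).1
      (isLeftCISemiring_of_isBooleanOrChainOrExt (.inl ⟨e⟩))
    rw [map_mul, map_mul, h]
  · refine (isLeftCISemiring_congr (opEquivOfComm fun x y => e.injective ?_)).1
      (isLeftCISemiring_of_isBooleanOrChainOrExt (.inr (.inl ⟨e⟩)))
    rw [map_mul, map_mul, ChainSemiring.mul_comm']
  · exact (isLeftCISemiring_congr ((RingEquiv.op e).trans (ExtSemiring.opEquiv R))).2
      ExtSemiring.isLeftCISemiring

theorem isLeftCISemiring_of_subsingleton {T : Type u} [Semiring T] [Subsingleton T] :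
    IsLeftCISemiring T := by
  intro M _ _ ⟨p, hp⟩
  have : Subsingleton M := hp.subsingleton
  exact isInjectiveSemimodule_of_subsingleton

/-- The opposite of an anti-bounded left CI-semiring is a left CI-semiring, by the classification
and the left-right symmetry of semisimplicity. -/
theorem IsLeftCISemiring.op {S : Type u} [Semiring S] (hS : IsLeftCISemiring S)
    (ha : IsAntiBounded S) : IsLeftCISemiring Sᵐᵒᵖ := by
  obtain ⟨R, _, T, _, hR, hT, ⟨e⟩⟩ := exists_equiv_prod hS ha
  let E : (R × T)ᵐᵒᵖ ≃+* Rᵐᵒᵖ × Tᵐᵒᵖ :=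
    { toFun := fun x => (.op x.unop.1, .op x.unop.2)
      invFun := fun x => .op (x.1.unop, x.2.unop)
      left_inv := fun _ => rfl
      right_inv := fun _ => rfl
      map_add' := fun _ _ => rfl
      map_mul' := fun _ _ => rfl }
  refine (isLeftCISemiring_congr ((RingEquiv.op e).trans E)).2
    (isLeftCISemiring_of_isSemisimpleRing.prod ?_)
  rcases hT with hT | hT
  · exact isLeftCISemiring_of_subsingleton
  · exact isLeftCISemiring_op_of_isBooleanOrChainOrExt hT

theorem IsAntiBounded.op {S : Type u} [Semiring S] (h : IsAntiBounded S) :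
    IsAntiBounded Sᵐᵒᵖ := fun s =>
  (h s.unop).imp (fun ⟨t, ht⟩ => ⟨.op t, congrArg MulOpposite.op ht⟩)
    fun ⟨t, ht⟩ => ⟨.op t, congrArg MulOpposite.op ht⟩

theorem isRightCISemiring_iff_left {S : Type u} [Semiring S] (ha : IsAntiBounded S) :
    IsRightCISemiring S ↔ IsLeftCISemiring S :=
  isRightCISemiring_iff_op.trans
    ⟨fun h => (isLeftCISemiring_congr (RingEquiv.opOp S)).2 (h.op ha.op), fun h => h.op ha⟩

/-! ### The classification -/

theorem isLeftCISemiring_iff {S : Type u} [hS : Semiring S] (ha : IsAntiBounded S) :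
    IsLeftCISemiring S ↔ IsSemisimpleRingAsSemiring S ∨ IsBooleanOrChainOrExt S ∨
      IsSemisimpleRingSumBooleanOrChainOrExt S := by
  constructor
  · intro h
    obtain ⟨R, _, T, _, hR, hT | hT, ⟨e⟩⟩ := exists_equiv_prod h ha
    · left
      have hneg : ∀ x : S, ∃ y, x + y = 0 := fun x =>
        ⟨e.symm (-(e x).1, 0), e.injective (by
          rw [map_add, map_zero, e.apply_symm_apply]
          exact Prod.ext (add_neg_cancel _) (Subsingleton.elim _ _))⟩
      let e' : R ≃+* S := (RingEquiv.ofBijective ((RingHom.fst R T).comp (e : S →+* R × T))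
        ⟨fun x y hxy => e.injective (Prod.ext hxy (Subsingleton.elim _ _)),
          fun r => ⟨e.symm (r, 0), by simp⟩⟩).symm
      let r : Ring S := ringOfExistsNeg S hneg
      exact ⟨r, rfl, RingEquiv.isSemisimpleRing e'⟩
    · exact .inr (.inr ⟨R, inferInstance, T, inferInstance, hR, hT, ⟨e⟩⟩)
  · rintro (⟨r, rfl, _⟩ | h | ⟨R, _, T, _, hR, hT, ⟨e⟩⟩)
    · exact isLeftCISemiring_of_isSemisimpleRing
    · exact isLeftCISemiring_of_isBooleanOrChainOrExt h
    · exact (isLeftCISemiring_congr e).2 (isLeftCISemiring_of_isSemisimpleRing.prod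
        (isLeftCISemiring_of_isBooleanOrChainOrExt hT))

theorem theorem4p20 (S : Type u) [Semiring S] (hS : IsAntiBounded S) :
    (IsLeftCISemiring S ↔
      IsSemisimpleRingAsSemiring S ∨ IsBooleanOrChainOrExt S ∨
        IsSemisimpleRingSumBooleanOrChainOrExt S) ∧
    (IsRightCISemiring S ↔
      IsSemisimpleRingAsSemiring S ∨ IsBooleanOrChainOrExt S ∨
        IsSemisimpleRingSumBooleanOrChainOrExt S) :=
  ⟨isLeftCISemiring_iff hS, (isRightCISemiring_iff_left hS).trans (isLeftCISemiring_iff hS)⟩
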